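/- **Setting.** Let $\tilde{\mathbb Z}^2=\{y=(t,x)\in\mathbb Z^2: t+x \text{ even}\}$. For $y=(t,x)$ let $e_y^\nearrow,e_y^\nwarrow,e_y^\searrow,e_y^\swarrow$ be the edges joining $y$ to $(t+1,x+1)$, $(t-1,x+1)$, $(t+1,x-1)$, $(t-1,x-1)$. A *rectangular domain* is a set $S=\{(t,x)\in\tilde{\mathbb Z}^2: a\le t+x\le b,\ c\le t-x\le d\}$ with $a\le b$, $c\le d$ even integers. Let $\bar S$ be the set of points of $\tilde{\mathbb Z}^2$ at distance at most $\sqrt2$ from $S$, $\partial\bar S=\bar S\setminus S$, and let $\mathcal E(\bar S)$ be the set of edges with an endpoint in $S$. A *flow field* is a function $\eta\ge 0$ on $\mathcal E(\bar S)$ with $\eta(e_y^\swarrow)-\eta(e_y^\nwarrow)=\eta(e_y^\nearrow)-\eta(e_y^\searrow)$ for all $y\in S$. For $\xi\ge0$ on $S$ and $\zeta^\circ=(\zeta^+,\zeta^-)\ge0$, with $\zeta^+$ defined at those $(t,x)\in S$ with $(t-1,x-1)\notin S$ and $\zeta^-$ at those with $(t-1,x+1)\notin S$, we write $\eta=\bar\eta(\zeta^\circ,\xi)$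 if for all $y\in S$ $$\eta(e_y^\nearrow)=\xi_y+[\eta(e_y^\swarrow)-\eta(e_y^\nwarrow)]^+,\qquad \eta(e_y^\searrow)=\xi_y+[\eta(e_y^\nwarrow)-\eta(e_y^\swarrow)]^+,$$ and $\eta(e_y^\swarrow)=\zeta^+_y$, $\eta(e_y^\nwarrow)=\zeta^-_y$ wherever $\zeta^+_y$, respectively $\zeta^-_y$, is defined. A *broken trace* is a sequence $\ell=(y_0,\dots,y_n)$, $n\ge1$, of points $y_i=(t_i,x_i)\in\tilde{\mathbb Z}^2$ with $x_i=x_{i-1}+1$ and $t_i=t_{i-1}\pm1$; its edges are $e_i=\langle y_{i-1},y_i\rangle$. We write $\ell\subseteq\bar S$ if all $e_i\in\mathcal E(\bar S)$, and $C(S)$ for the set of *crossing* traces, those $\ell\subseteq\bar S$ with $y_0,y_n\in\partial\bar S$. We write $\ell\subseteq\ell'$ if $\ell$ is a block of consecutive points of $\ell'$. We write $\ell'\preceq\ell$ if $t'\le t$ whenever $(t',x)\in\ell'$ and $(t,x)\in\ell$ have the same $x$, and $t'\le t$ for some $(t',x')\in\ell'$, $(t,x)\in\ell$; and $\ell'\prec\ell$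 if moreover $\ell\neq\ell'$. For a trace $\ell$ define the flow $\bar\eta(\ell)(e)=1$ if $e$ is an edge of $\ell$ and $0$ otherwise; the birth field $\xi(\ell)_{t,x}=1$ if $(t,x),(t+1,x+1),(t+1,x-1)\in\ell$ and $0$ otherwise; and boundary data $\zeta^\circ(\ell)$ by $\zeta^\pm(\ell)_{t,x}=1$ if $(t,x)\in\ell\cap S$ and $(t-1,x\mp1)\in\ell\cap\partial\bar S$, and $0$ otherwise. Let $\eta$ be a flow field. Its *atoms* are the pairs $(e,p)$ with $e\in\mathcal E(\bar S)$ and $0<p\le\eta(e)$. For $y\in S$ put $\beta_y=\min(\eta(e_y^\nearrow),\eta(e_y^\searrow))$, and let $(e_1,p_1)\sim(e_2,p_2)$ if for some $y\in S$ one of the following holds: 1. $e_1=e_y^\swarrow$, $e_2=e_y^\nwarrow$, $0<p_1\le\min(\eta(e_1),\eta(e_2))$, $p_2=p_1$; 2. $e_1=e_y^\searrow$, $e_2=e_y^\nwarrow$, $\eta(e_y^\swarrow)<p_2\le\eta(e_2)$, $p_1=p_2-\eta(e_y^\swarrow)$; 3. $e_1=e_y^\swarrow$, $e_2=e_y^\nearrow$,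 $\eta(e_y^\nwarrow)<p_1\le\eta(e_1)$, $p_2=p_1-\eta(e_y^\nwarrow)$; 4. $e_1=e_y^\searrow$, $e_2=e_y^\nearrow$, $\eta(e_i)-\beta_y<p_i\le\eta(e_i)$ for $i=1,2$, $\eta(e_1)-p_1=\eta(e_2)-p_2$. For intervals $J_1,J_2$ of the form $(p,p']$ let $(e_1,J_1)\sim(e_2,J_2)$ if each $p_1\in J_1$ has a $p_2\in J_2$ with $(e_1,p_1)\sim(e_2,p_2)$, and vice versa. A *broken line of $\eta$ with trace* $\ell\subseteq\bar S$ consists of intervals $J_i\subseteq(0,\eta(e_i)]$ of equal length, one for each edge $e_i$ of $\ell$, with $(e_{i-1},J_{i-1})\sim(e_i,J_i)$ for $i=2,\dots,n$; its weight is $|J_1|$ (zero if empty). Let $w_\eta(\ell)$ be the maximal weight of a broken line of $\eta$ with trace $\ell$. **Theorem.** Let $S$ be a rectangular domain. *(i)* Let $n\ge0$, $\ell_1\prec\dots\prec\ell_n$ in $C(S)$ and $w_1,\dots,w_n>0$. There is a unique flow field $\eta$ on $\mathcal E(\bar S)$ such that for every $\ell\in C(S)$ $$w_\eta(\ell)=\begin{cases}w_j,&\ell=\ell_j\text{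 for some }j,\\0,&\text{otherwise.}\end{cases}\tag{1}$$ Moreover $$\eta=\sum_jw_j\,\bar\eta(\ell_j),\qquad \zeta^\circ=\sum_jw_j\,\zeta^\circ(\ell_j),\qquad \xi=\sum_jw_j\,\xi(\ell_j),\tag{2}$$ where $(\zeta^\circ,\xi)$ is the unique pair with $\eta=\bar\eta(\zeta^\circ,\xi)$, and $$w_\eta(\ell)=\sum_{\ell'\in C(S),\ \ell\subseteq\ell'}w_\eta(\ell')\qquad\text{for every broken trace }\ell\subseteq\bar S.\tag{3}$$ *(ii)* Conversely, for every flow field $\eta$ on $\mathcal E(\bar S)$ there is a unique finite set of pairs $(\ell_j,w_j)$ with $\ell_j\in C(S)$ and $w_j>0$ that satisfies (1). The set $\{\ell_j\}$ is totally ordered by $\preceq$, and (2) and (3) hold. -/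

import Mathlib

namespace BrokenLines

/-! ### The lattice, rectangular domains, edges -/

/-- A space-time point `y = (t, x)`; the first coordinate is the time `t`. -/
abbrev Site := ℤ × ℤ

/-- The even sublattice: `t` and `x` have the same parity. -/
def evenLattice : Set Site := {y | Even (y.1 + y.2)}

/-- A rectangle of the even lattice with sides parallel to the two diagonals, that is, a hexagonal
domain whose left and right vertical sides consist of one point each. -/
def IsRectangularDomain (S : Set Site) : Prop :=
  ∃ a b c d : ℤ, Even a ∧ Even b ∧ Even c ∧ Even d ∧ a ≤ b ∧ c ≤ d ∧
    S = {y ∈ evenLattice | a ≤ y.1 + y.2 ∧ y.1 + y.2 ≤ b ∧ c ≤ y.1 - y.2 ∧ y.1 - y.2 ≤ d}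

/-- `S̄`: the points of the even lattice at Euclidean distance at most `√2` from `S`. -/
def closedDomain (S : Set Site) : Set Site :=
  {y ∈ evenLattice | ∃ z ∈ S, (y.1 - z.1) ^ 2 + (y.2 - z.2) ^ 2 ≤ 2}

/-- `∂S̄ = S̄ \ S`. -/
def outerBoundary (S : Set Site) : Set Site := closedDomain S \ S

/-- The sites at `±(1, 1)` and `±(1, -1)` from `y`. -/
def ne (y : Site) : Site := (y.1 + 1, y.2 + 1)
def nw (y : Site) : Site := (y.1 - 1, y.2 + 1)
def se (y : Site) : Site := (y.1 + 1, y.2 - 1)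
def sw (y : Site) : Site := (y.1 - 1, y.2 - 1)

/-- Edges are unordered pairs of sites; only those between diagonal neighbours are used. -/
abbrev Edge := Sym2 Site

/-- The four edges incident with `y`. -/
def eNE (y : Site) : Edge := s(y, ne y)
def eNW (y : Site) : Edge := s(y, nw y)
def eSE (y : Site) : Edge := s(y, se y)
def eSW (y : Site) : Edge := s(y, sw y)

/-- `𝓔(S̄)`: the edges with at least one endpoint in `S`. -/
def edgeSet (S : Set Site) : Set Edge :=
  {e | ∃ y ∈ S, e = eNE y ∨ e = eNW y ∨ e = eSE y ∨ e = eSW y}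

/-! ### Flow fields -/

/-- `η` is a flow field in `𝓔(S̄)`: nonnegative, with the conservation law at each site of `S`.
A field on `𝓔(S̄)` is identified with its extension by zero to all edges. -/
structure IsFlowField (S : Set Site) (η : Edge → ℝ) : Prop where
  nonneg : ∀ e ∈ edgeSet S, 0 ≤ η e
  conservation : ∀ y ∈ S, η (eSW y) - η (eNW y) = η (eNE y) - η (eSE y)
  eq_zero : ∀ e, e ∉ edgeSet S → η e = 0

/-- The southwest side of `S`, through which ascending particles enter. -/
def southwestSide (S : Set Site) : Set Site := {y ∈ S | sw y ∉ S}

/-- The northwest side of `S`, through which descending particles enter. -/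
def northwestSide (S : Set Site) : Set Site := {y ∈ S | nw y ∉ S}

/-- Boundary data `(ζ⁺, ζ⁻)`: the ascending flow entering through the southwest side and the
descending flow entering through the northwest side. -/
abbrev BoundaryFlow := (Site → ℝ) × (Site → ℝ)

/-- `η` is the flow field `η̄(ζ, ξ)` with entering flow `ζ` and birth field `ξ`. At each site of `S`
the incoming ascending and descending flows annihilate each other as far as possible, the remainder
continues, and `ξ y` is added to both outgoing flows. The flow arriving at a site through an edge
is the flow that left the neighbouring site through it or, at the boundary, the entering flow.
`ζ⁺`, `ζ⁻`, `ξ` are extended by zero from the southwest side, the northwest side and `S`. -/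
structure IsFlowFieldOf (S : Set Site) (ζ : BoundaryFlow) (ξ : Site → ℝ) (η : Edge → ℝ) :
    Prop where
  boundary_nonneg : ∀ y, 0 ≤ ζ.1 y ∧ 0 ≤ ζ.2 y
  birth_nonneg : ∀ y, 0 ≤ ξ y
  boundary_plus_eq_zero : ∀ y, y ∉ southwestSide S → ζ.1 y = 0
  boundary_minus_eq_zero : ∀ y, y ∉ northwestSide S → ζ.2 y = 0
  birth_eq_zero : ∀ y, y ∉ S → ξ y = 0
  flow_eq_zero : ∀ e, e ∉ edgeSet S → η e = 0
  entering_plus : ∀ y ∈ southwestSide S, η (eSW y) = ζ.1 y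
  entering_minus : ∀ y ∈ northwestSide S, η (eNW y) = ζ.2 y
  leaving_plus : ∀ y ∈ S, η (eNE y) = ξ y + max (η (eSW y) - η (eNW y)) 0
  leaving_minus : ∀ y ∈ S, η (eSE y) = ξ y + max (η (eNW y) - η (eSW y)) 0

/-- The mass born at `y` in the flow field `η`. -/
def birthAt (η : Edge → ℝ) (y : Site) : ℝ := min (η (eNE y)) (η (eSE y))

/-! ### Broken traces -/

/-- A broken trace, given by its sites `y₀, …, yₙ`, `n ≥ 1`, in the even lattice, where `x`
increases by one and `t` changes by `±1` at each step. -/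
@[ext]
structure BrokenTrace where
  sites : List Site
  two_le_length : 2 ≤ sites.length
  mem_evenLattice : ∀ y ∈ sites, y ∈ evenLattice
  isChain : sites.IsChain (fun y z => z = ne y ∨ z = nw y)

namespace BrokenTrace

/-- The edges `e₁, …, eₙ` of a trace. -/
def edges (l : BrokenTrace) : List Edge :=
  List.zipWith (fun y z => s(y, z)) l.sites l.sites.tail

/-- `ℓ ⊆ S̄`: all edges of `ℓ` are in `𝓔(S̄)`. -/
def IsIn (l : BrokenTrace) (S : Set Site) : Prop := ∀ e ∈ l.edges, e ∈ edgeSet S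

/-- `C(S)`: the traces in `S̄` whose two endpoints are in `∂S̄`. -/
def crossing (S : Set Site) : Set BrokenTrace :=
  {l | l.IsIn S ∧ (∃ y ∈ l.sites.head?, y ∈ outerBoundary S) ∧
    ∃ y ∈ l.sites.getLast?, y ∈ outerBoundary S}

/-- `ℓ ⊆ ℓ'`: the sites of `ℓ` are consecutive sites of `ℓ'`. -/
def IsPartOf (l l' : BrokenTrace) : Prop := l.sites <:+: l'.sites

/-- `ℓ ≼ ℓ'`: `ℓ'` is to the right of `ℓ`, that is, `t(x) ≤ t'(x)` for all common `x`, and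
`t(x) ≤ t'(x')` for some `x` in the domain of `ℓ` and `x'` in the domain of `ℓ'`. -/
def Le (l l' : BrokenTrace) : Prop :=
  (∀ y ∈ l.sites, ∀ y' ∈ l'.sites, y.2 = y'.2 → y.1 ≤ y'.1) ∧
    ∃ y ∈ l.sites, ∃ y' ∈ l'.sites, y.1 ≤ y'.1

/-- `ℓ ≺ ℓ'`. -/
def Lt (l l' : BrokenTrace) : Prop := l.Le l' ∧ l ≠ l'

/-- The left corners of a trace. -/
def leftCorners (l : BrokenTrace) : Set Site :=
  {y | y ∈ l.sites ∧ ne y ∈ l.sites ∧ se y ∈ l.sites}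

/-- The flow `η̄(ℓ)` of a single trace. -/
noncomputable def flow (l : BrokenTrace) : Edge → ℝ :=
  Set.indicator {e | e ∈ l.edges} 1

/-- The birth field `ξ(ℓ)` of a single trace. -/
noncomputable def birth (l : BrokenTrace) : Site → ℝ :=
  Set.indicator l.leftCorners 1

/-- The boundary data `ζ°(ℓ)` of a single trace. -/
noncomputable def boundaryFlow (l : BrokenTrace) (S : Set Site) : BoundaryFlow :=
  (Set.indicator {y | y ∈ l.sites ∧ y ∈ S ∧ sw y ∈ l.sites ∧ sw y ∈ outerBoundary S} 1,
    Set.indicator {y | y ∈ l.sites ∧ y ∈ S ∧ nw y ∈ l.sites ∧ nw y ∈ outerBoundary S} 1)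

end BrokenTrace

/-! ### Association of atoms, broken lines, weights -/

/-- The association rules at the site `y` for the atoms `(e₁, p₁)`, on an edge reaching `y` from
below, and `(e₂, p₂)`, on an edge reaching `y` from above. -/
def AtomAssocAt (η : Edge → ℝ) (y : Site) (e₁ : Edge) (p₁ : ℝ) (e₂ : Edge) (p₂ : ℝ) : Prop :=
  (e₁ = eSW y ∧ e₂ = eNW y ∧ p₁ ∈ Set.Ioc 0 (min (η e₁) (η e₂)) ∧ p₂ = p₁) ∨
  (e₁ = eSE y ∧ e₂ = eNW y ∧ p₂ ∈ Set.Ioc (η (eSW y)) (η e₂) ∧ p₁ = p₂ - η (eSW y)) ∨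
  (e₁ = eSW y ∧ e₂ = eNE y ∧ p₁ ∈ Set.Ioc (η (eNW y)) (η e₁) ∧ p₂ = p₁ - η (eNW y)) ∨
  (e₁ = eSE y ∧ e₂ = eNE y ∧ p₁ ∈ Set.Ioc (η e₁ - birthAt η y) (η e₁) ∧
    p₂ ∈ Set.Ioc (η e₂ - birthAt η y) (η e₂) ∧ η e₁ - p₁ = η e₂ - p₂)

/-- `(e₁, p₁) ∼ (e₂, p₂)`. -/
def AtomAssoc (S : Set Site) (η : Edge → ℝ) (e₁ : Edge) (p₁ : ℝ) (e₂ : Edge) (p₂ : ℝ) : Prop :=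
  ∃ y ∈ S, AtomAssocAt η y e₁ p₁ e₂ p₂

/-- An edge with an interval `(a, b]`, given by the pair `(a, b)`; it is empty if `b ≤ a`. -/
abbrev Strand := Edge × (ℝ × ℝ)

/-- The interval `J = (a, b]`. -/
def Strand.interval (s : Strand) : Set ℝ := Set.Ioc s.2.1 s.2.2

/-- `|J|`, which is zero for the empty interval. -/
noncomputable def Strand.width (s : Strand) : ℝ := max (s.2.2 - s.2.1) 0

/-- `(e₁, J₁) ∼ (e₂, J₂)`. -/
def StrandAssoc (S : Set Site) (η : Edge → ℝ) (s₁ s₂ : Strand) : Prop :=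
  (∀ p₁ ∈ s₁.interval, ∃ p₂ ∈ s₂.interval, AtomAssoc S η s₁.1 p₁ s₂.1 p₂) ∧
    ∀ p₂ ∈ s₂.interval, ∃ p₁ ∈ s₁.interval, AtomAssoc S η s₁.1 p₁ s₂.1 p₂

/-- A broken line: a trace with an interval on each of its edges, all of the same width. -/
structure BrokenLine where
  trace : BrokenTrace
  strands : List Strand
  edges_eq : strands.map Prod.fst = trace.edges
  width_eq : ∀ s ∈ strands, ∀ s' ∈ strands, s.width = s'.width

/-- The weight `|J₁|` of a broken line. -/
noncomputable def BrokenLine.weight (γ : BrokenLine) : ℝ :=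
  match γ.strands with
  | [] => 0
  | s :: _ => s.width

/-- `B(η)`: the broken lines in `S̄` that are associated with the flow field `η`. Their intervals
consist of atoms of `η`, and consecutive ones are associated. -/
def associatedLines (S : Set Site) (η : Edge → ℝ) : Set BrokenLine :=
  {γ | γ.trace.IsIn S ∧ (∀ s ∈ γ.strands, s.interval ⊆ Set.Ioc 0 (η s.1)) ∧
    γ.strands.IsChain (StrandAssoc S η)}

/-- `w_η(ℓ)`: the maximal weight of a broken line in `B(η)` with trace `ℓ`. -/
noncomputable def traceWeight (S : Set Site) (η : Edge → ℝ) (l : BrokenTrace) : ℝ :=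
  sSup {r | ∃ γ ∈ associatedLines S η, γ.trace = l ∧ γ.weight = r}

/-! ### The relations in the decomposition theorem -/

/-- For every crossing trace `ℓ`, `w_η(ℓ)` is `w j` if `ℓ = ℓ j` for some `j`, and `0` otherwise. -/
def HasCrossingWeights (S : Set Site) (η : Edge → ℝ) {n : ℕ} (l : Fin n → BrokenTrace)
    (w : Fin n → ℝ) : Prop :=
  ∀ k ∈ BrokenTrace.crossing S,
    (∀ j, k = l j → traceWeight S η k = w j) ∧ ((∀ j, k ≠ l j) → traceWeight S η k = 0)

/-- `η = ∑ w j η̄(ℓ j)`, and the unique `ζ`, `ξ` with `η = η̄(ζ, ξ)` are `∑ w j ζ°(ℓ j)` and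
`∑ w j ξ(ℓ j)`. -/
def Decomposes (S : Set Site) (η : Edge → ℝ) {n : ℕ} (l : Fin n → BrokenTrace)
    (w : Fin n → ℝ) : Prop :=
  η = ∑ j, w j • (l j).flow ∧
    ∀ (ζ : BoundaryFlow) (ξ : Site → ℝ), IsFlowFieldOf S ζ ξ η ↔
      ζ = ∑ j, w j • (l j).boundaryFlow S ∧ ξ = ∑ j, w j • (l j).birth

/-- For every trace `ℓ` in `S̄`, `w_η(ℓ)` is the sum of `w_η(ℓ')` over the crossing traces `ℓ'`
that contain `ℓ`. -/
def WeightsAdd (S : Set Site) (η : Edge → ℝ) : Prop :=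
  ∀ k : BrokenTrace, k.IsIn S →
    HasSum (fun k' : {k' // k' ∈ BrokenTrace.crossing S ∧ k.IsPartOf k'} => traceWeight S η k')
      (traceWeight S η k)

end BrokenLines

open BrokenLines

/-!
In the coordinates `t + x` and `t - x`, a broken trace is a lattice path each of whose steps
increases `t + x` or decreases `t - x` by two, and the conservation law says that the total flow
arriving at a site from below equals the total flow leaving it upwards. A flow field `η` therefore
has a potential `P` on the faces of the lattice, whose difference between the right and the left
face of an edge `e` is `η e` (`isPotential_potential`). Let the level of an atom `(e, p)` be `p`
plus the value of `P` on the left face of `e`. At each site, the atoms arriving from below, stacked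
from left to right, and the atoms leaving upwards, stacked likewise, fill the same interval of
levels, and the four association rules match atoms of equal level (`level_eq_of_atomAssoc`,
`atomAssoc_of_level_eq`). Hence a broken line with trace `ℓ` is a set of levels common to all edges
of `ℓ`, and `w_η(ℓ)` is the length of the interval `levels P ℓ` of all common levels
(`traceWeight_eq_volume`).

Following a level `h` upwards and downwards extends each trace at level `h` to a crossing trace at
level `h` (`exists_crossing`), of which there is only one since `P` is monotone (`crossing_unique`).
So `levels P ℓ` is partitioned by the levels of the crossing traces containing `ℓ`, which is the
additivity of the weights (`weightsAdd`). For traces with one edge, or with one left corner, it says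
that the flow, the entering flow and the births are superpositions of those of the crossing traces
(`decomposes`). Higher levels run further to the right (`le_of_levels`), so the crossing traces of
positive weight are totally ordered (`exists_orderedFamily`).

Conversely, the flow of a single crossing trace has as its potential the indicator function of the
faces to the right of the trace (`isPotential_rightIndicator`), and these functions decrease along a
chain (`rightIndicator_le_of_le`). In the superposition of a chain `ℓ₁ ≺ ⋯ ≺ ℓₙ` with weights `wⱼ`,
the levels of `ℓⱼ` are therefore those in the interval `(w₁ + ⋯ + wⱼ₋₁, w₁ + ⋯ + wⱼ]`, and these
intervals exhaust all levels (`hasCrossingWeights_sum`).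
-/

namespace BrokenLines

/-! ### Rectangles and their edges -/

/-- The rectangle `2a ≤ t + x ≤ 2b`, `2c ≤ t - x ≤ 2d` of the even lattice. -/
def rectangle (a b c d : ℤ) : Set Site :=
  {y ∈ evenLattice | 2 * a ≤ y.1 + y.2 ∧ y.1 + y.2 ≤ 2 * b ∧ 2 * c ≤ y.1 - y.2 ∧ y.1 - y.2 ≤ 2 * d}

theorem mem_evenLattice_iff {y : Site} : y ∈ evenLattice ↔ (y.1 + y.2) % 2 = 0 :=
  Int.even_iff

theorem mem_rectangle {a b c d : ℤ} {y : Site} :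
    y ∈ rectangle a b c d ↔ (y.1 + y.2) % 2 = 0 ∧ 2 * a ≤ y.1 + y.2 ∧ y.1 + y.2 ≤ 2 * b ∧
      2 * c ≤ y.1 - y.2 ∧ y.1 - y.2 ≤ 2 * d := by
  simp only [rectangle, mem_evenLattice_iff, Set.mem_ofPred_eq]

theorem IsRectangularDomain.exists_eq_rectangle {S : Set Site} (hS : IsRectangularDomain S) :
    ∃ a b c d : ℤ, a ≤ b ∧ c ≤ d ∧ S = rectangle a b c d := by
  obtain ⟨a, b, c, d, ⟨a', rfl⟩, ⟨b', rfl⟩, ⟨c', rfl⟩, ⟨d', rfl⟩, hab, hcd, rfl⟩ := hS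
  refine ⟨a', b', c', d', by omega, by omega, ?_⟩
  simp only [rectangle, two_mul]

theorem rectangle_subset_evenLattice {a b c d : ℤ} : rectangle a b c d ⊆ evenLattice :=
  fun _ hy => hy.1

theorem eSW_eq (y : Site) : eSW y = eNE (sw y) := by
  simp [eSW, eNE, sw, ne, Sym2.eq_swap]

theorem eSE_eq (y : Site) : eSE y = eNW (se y) := by
  simp [eSE, eNW, se, nw, Sym2.eq_swap]

theorem eSW_ne (y : Site) : eSW (ne y) = eNE y := by
  simp [eSW, eNE, sw, ne, Sym2.eq_swap]

theorem eSE_nw (y : Site) : eSE (nw y) = eNW y := by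
  simp [eSE, eNW, se, nw, Sym2.eq_swap]

theorem eNE_inj {y z : Site} : eNE y = eNE z ↔ y = z := by
  simp only [eNE, ne, Sym2.eq_iff, Prod.ext_iff]
  constructor
  · rintro (h | h)
    · exact h.1
    · omega
  · rintro h; omega

theorem eNW_inj {y z : Site} : eNW y = eNW z ↔ y = z := by
  simp only [eNW, nw, Sym2.eq_iff, Prod.ext_iff]
  constructor
  · rintro (h | h)
    · exact h.1
    · omega
  · rintro h; omega

theorem eNE_ne_eNW {y z : Site} : eNE y ≠ eNW z := by
  simp only [eNE, eNW, ne, nw, Ne, Sym2.eq_iff, Prod.ext_iff]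
  omega

theorem eNE_mem_edgeSet {S : Set Site} {y : Site} : eNE y ∈ edgeSet S ↔ y ∈ S ∨ ne y ∈ S := by
  constructor
  · rintro ⟨z, hz, h | h | h | h⟩
    · rw [eNE_inj] at h; subst h; exact .inl hz
    · exact absurd h eNE_ne_eNW
    · rw [eSE_eq] at h; exact absurd h eNE_ne_eNW
    · rw [eSW_eq, eNE_inj] at h; subst h; right; simpa [sw, ne] using hz
  · rintro (h | h)
    · exact ⟨y, h, .inl rfl⟩
    · exact ⟨_, h, .inr (.inr (.inr (eSW_ne y).symm))⟩

theorem eNW_mem_edgeSet {S : Set Site} {y : Site} : eNW y ∈ edgeSet S ↔ y ∈ S ∨ nw y ∈ S := by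
  constructor
  · rintro ⟨z, hz, h | h | h | h⟩
    · exact absurd h.symm eNE_ne_eNW
    · rw [eNW_inj] at h; subst h; exact .inl hz
    · rw [eSE_eq, eNW_inj] at h; subst h; right; simpa [se, nw] using hz
    · rw [eSW_eq] at h; exact absurd h.symm eNE_ne_eNW
  · rintro (h | h)
    · exact ⟨y, h, .inr (.inl rfl)⟩
    · exact ⟨_, h, .inr (.inr (.inl (eSE_nw y).symm))⟩

theorem exists_eq_of_mem_edgeSet {S : Set Site} {e : Edge} (he : e ∈ edgeSet S) :
    ∃ y, e = eNE y ∨ e = eNW y := by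
  obtain ⟨y, -, h | h | h | h⟩ := he
  · exact ⟨y, .inl h⟩
  · exact ⟨y, .inr h⟩
  · exact ⟨se y, .inr (h.trans (eSE_eq y))⟩
  · exact ⟨sw y, .inl (h.trans (eSW_eq y))⟩

theorem mem_outerBoundary_of_adjacent {S : Set Site} (hS : S ⊆ evenLattice) {y : Site}
    (hy : y ∉ S) (h : ne y ∈ S ∨ nw y ∈ S ∨ se y ∈ S ∨ sw y ∈ S) : y ∈ outerBoundary S := by
  have key : ∀ z ∈ S, (z.1 = y.1 + 1 ∨ z.1 = y.1 - 1) → (z.2 = y.2 + 1 ∨ z.2 = y.2 - 1) →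
      y ∈ outerBoundary S := by
    intro z hz h1 h2
    have hz' := mem_evenLattice_iff.1 (hS hz)
    refine ⟨⟨mem_evenLattice_iff.2 (by omega), z, hz, ?_⟩, hy⟩
    have e1 : (y.1 - z.1) ^ 2 = 1 := by rcases h1 with h | h <;> rw [h] <;> ring
    have e2 : (y.2 - z.2) ^ 2 = 1 := by rcases h2 with h | h <;> rw [h] <;> ring
    omega
  rcases h with h | h | h | h <;> exact key _ h (by simp [ne, nw, se, sw]) (by simp [ne, nw, se, sw])

/-! ### Broken traces as lattice paths -/

namespace BrokenTrace

variable (l : BrokenTrace)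

/-- The lowest site of a trace. -/
def bottom : Site := l.sites[0]'(by have := l.two_le_length; omega)

/-- The highest site of a trace. -/
def top : Site := l.sites[l.sites.length - 1]'(by have := l.two_le_length; omega)

variable {l}

theorem getElem_succ {i : ℕ} (h : i + 1 < l.sites.length) :
    l.sites[i + 1] = ne l.sites[i] ∨ l.sites[i + 1] = nw l.sites[i] :=
  List.isChain_iff_getElem.1 l.isChain i h

theorem getElem_height {i : ℕ} (h : i < l.sites.length) :
    (l.sites[i]).2 = l.bottom.2 + i := by
  induction i with
  | zero => simp [bottom]
  | succ i ih =>
    have := ih (by omega)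
    rcases getElem_succ h with h' | h' <;> rw [h'] <;> simp [ne, nw] <;> omega

theorem bottom_mem : l.bottom ∈ l.sites := List.getElem_mem _

theorem top_mem : l.top ∈ l.sites := List.getElem_mem _

theorem top_height : l.top.2 = l.bottom.2 + l.sites.length - 1 := by
  have := l.two_le_length
  rw [top, getElem_height]; omega

theorem bottom_height_lt_top : l.bottom.2 < l.top.2 := by
  have := l.two_le_length
  rw [top_height]; omega

theorem exists_getElem {y : Site} (hy : y ∈ l.sites) :
    ∃ (i : ℕ) (h : i < l.sites.length), l.sites[i] = y ∧ y.2 = l.bottom.2 + i := by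
  obtain ⟨i, h, rfl⟩ := List.getElem_of_mem hy
  exact ⟨i, h, rfl, getElem_height h⟩

theorem bottom_le {y : Site} (hy : y ∈ l.sites) : l.bottom.2 ≤ y.2 := by
  obtain ⟨i, h, -, h'⟩ := exists_getElem hy; omega

theorem le_top {y : Site} (hy : y ∈ l.sites) : y.2 ≤ l.top.2 := by
  obtain ⟨i, h, -, h'⟩ := exists_getElem hy
  rw [top_height]; omega

/-- A trace has a site at each height between its endpoints. -/
theorem exists_site {x : ℤ} (h₁ : l.bottom.2 ≤ x) (h₂ : x ≤ l.top.2) :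
    ∃ y ∈ l.sites, y.2 = x := by
  rw [top_height] at h₂
  have h : (x - l.bottom.2).toNat < l.sites.length := by omega
  exact ⟨_, List.getElem_mem h, by rw [getElem_height]; omega⟩

/-- Going up a trace, `t + x` does not decrease and `t - x` does not increase. -/
theorem slope {y z : Site} (hy : y ∈ l.sites) (hz : z ∈ l.sites) (h : y.2 ≤ z.2) :
    y.1 + y.2 ≤ z.1 + z.2 ∧ z.1 - z.2 ≤ y.1 - y.2 := by
  obtain ⟨i, hi, rfl, hi'⟩ := exists_getElem hy
  obtain ⟨j, hj, rfl, hj'⟩ := exists_getElem hz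
  have hij : i ≤ j := by omega
  clear hy hz h hi' hj'
  induction j, hij using Nat.le_induction with
  | base => simp
  | succ j hij ih =>
    have := ih (by omega)
    rcases getElem_succ hj with h' | h' <;> rw [h'] <;> simp [ne, nw] <;> omega

theorem site_unique {y z : Site} (hy : y ∈ l.sites) (hz : z ∈ l.sites) (h : y.2 = z.2) :
    y = z := by
  have h₁ := slope hy hz h.le
  have h₂ := slope hz hy h.ge
  ext <;> omega

theorem exists_next {y : Site} (hy : y ∈ l.sites) (h : y.2 < l.top.2) :
    ne y ∈ l.sites ∨ nw y ∈ l.sites := by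
  obtain ⟨i, hi, rfl, hi'⟩ := exists_getElem hy
  rw [top_height] at h
  have hs : i + 1 < l.sites.length := by omega
  rcases getElem_succ hs with h' | h' <;> rw [← h'] <;> simp

theorem exists_prev {y : Site} (hy : y ∈ l.sites) (h : l.bottom.2 < y.2) :
    sw y ∈ l.sites ∨ se y ∈ l.sites := by
  obtain ⟨i, hi, rfl, hi'⟩ := exists_getElem hy
  obtain ⟨j, rfl⟩ : ∃ j, i = j + 1 := ⟨i - 1, by omega⟩
  have hm : l.sites[j]'(by omega) ∈ l.sites := List.getElem_mem _
  rcases getElem_succ hi with h' | h' <;> rw [h']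
  · left; simp [sw, ne, hm]
  · right; simp [se, nw, hm]

theorem mem_edges {e : Edge} :
    e ∈ l.edges ↔ ∃ y ∈ l.sites, (ne y ∈ l.sites ∧ e = eNE y) ∨ (nw y ∈ l.sites ∧ e = eNW y) := by
  have key : e ∈ l.edges ↔
      ∃ (i : ℕ) (h : i + 1 < l.sites.length), s(l.sites[i], l.sites[i + 1]) = e := by
    rw [edges, List.mem_iff_getElem]
    simp only [List.length_zipWith, List.length_tail, List.getElem_zipWith, List.getElem_tail]
    constructor
    · rintro ⟨i, h, he⟩; exact ⟨i, by omega, he⟩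
    · rintro ⟨i, h, he⟩; exact ⟨i, by omega, he⟩
  rw [key]
  constructor
  · rintro ⟨i, h, rfl⟩
    refine ⟨l.sites[i], List.getElem_mem _, ?_⟩
    have hm : l.sites[i + 1] ∈ l.sites := List.getElem_mem _
    rcases getElem_succ h with h' | h'
    · left; rw [h'] at hm ⊢; exact ⟨hm, rfl⟩
    · right; rw [h'] at hm ⊢; exact ⟨hm, rfl⟩
  · rintro ⟨y, hy, h⟩
    obtain ⟨i, hi, rfl, hi'⟩ := exists_getElem hy
    have aux : ∀ z ∈ l.sites, z.2 = (l.sites[i]).2 + 1 →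
        ∃ h : i + 1 < l.sites.length, l.sites[i + 1] = z := by
      intro z hz hz'
      obtain ⟨j, hj, rfl, hj'⟩ := exists_getElem hz
      obtain rfl : j = i + 1 := by omega
      exact ⟨hj, rfl⟩
    rcases h with ⟨hz, rfl⟩ | ⟨hz, rfl⟩
    all_goals
      obtain ⟨h, h'⟩ := aux _ hz (by simp [ne, nw])
      exact ⟨i, h, by rw [h']; rfl⟩

theorem eNE_mem_edges {y : Site} : eNE y ∈ l.edges ↔ y ∈ l.sites ∧ ne y ∈ l.sites := by
  rw [mem_edges]
  constructor
  · rintro ⟨z, hz, ⟨h, h'⟩ | ⟨h, h'⟩⟩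
    · rw [eNE_inj] at h'; subst h'; exact ⟨hz, h⟩
    · exact absurd h' eNE_ne_eNW
  · rintro ⟨h, h'⟩; exact ⟨y, h, .inl ⟨h', rfl⟩⟩

theorem eNW_mem_edges {y : Site} : eNW y ∈ l.edges ↔ y ∈ l.sites ∧ nw y ∈ l.sites := by
  rw [mem_edges]
  constructor
  · rintro ⟨z, hz, ⟨h, h'⟩ | ⟨h, h'⟩⟩
    · exact absurd h'.symm eNE_ne_eNW
    · rw [eNW_inj] at h'; subst h'; exact ⟨hz, h⟩
  · rintro ⟨h, h'⟩; exact ⟨y, h, .inr ⟨h', rfl⟩⟩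

theorem eSW_mem_edges {y : Site} : eSW y ∈ l.edges ↔ y ∈ l.sites ∧ sw y ∈ l.sites := by
  rw [eSW_eq, eNE_mem_edges, and_comm]
  simp [sw, ne]

theorem eSE_mem_edges {y : Site} : eSE y ∈ l.edges ↔ y ∈ l.sites ∧ se y ∈ l.sites := by
  rw [eSE_eq, eNW_mem_edges, and_comm]
  simp [se, nw]

theorem edges_ne_nil : l.edges ≠ [] := by
  have := l.two_le_length
  intro h
  have h' := congrArg List.length h
  simp [edges] at h'
  omega

/-- As its heights are consecutive, a trace is part of another one as soon as its sites are among
those of the other. -/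
theorem isPartOf_iff_subset {k : BrokenTrace} : k.IsPartOf l ↔ k.sites ⊆ l.sites := by
  refine ⟨fun h => h.subset, fun h => ?_⟩
  obtain ⟨m, hm, hm', hm''⟩ := exists_getElem (h k.bottom_mem)
  obtain ⟨n, hn, hn', hn''⟩ := exists_getElem (h k.top_mem)
  have hk := k.two_le_length
  have ht := k.top_height
  have : k.sites = (l.sites.drop m).take k.sites.length := by
    apply List.ext_getElem
    · simp; omega
    · intro i h₁ h₂
      rw [List.getElem_take, List.getElem_drop]
      apply site_unique (h (List.getElem_mem _)) (List.getElem_mem _)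
      rw [getElem_height, getElem_height]
      push_cast; omega
  rw [IsPartOf, this]
  exact (List.take_prefix _ _).isInfix.trans (List.drop_suffix _ _).isInfix

theorem IsPartOf.edges_subset {k : BrokenTrace} (h : k.IsPartOf l) : k.edges ⊆ l.edges := by
  rw [isPartOf_iff_subset] at h
  intro e he
  rw [mem_edges] at he ⊢
  obtain ⟨y, hy, h' | h'⟩ := he
  · exact ⟨y, h hy, .inl ⟨h h'.1, h'.2⟩⟩
  · exact ⟨y, h hy, .inr ⟨h h'.1, h'.2⟩⟩

theorem ext_of_subset {k : BrokenTrace} (h₁ : k.sites ⊆ l.sites) (h₂ : l.sites ⊆ k.sites) :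
    k = l :=
  BrokenTrace.ext (List.infix_antisymm (isPartOf_iff_subset.2 h₁) (isPartOf_iff_subset.2 h₂))

/-- Every site of a trace is an endpoint of one of its edges. -/
theorem exists_edge {y : Site} (hy : y ∈ l.sites) :
    eNE y ∈ l.edges ∨ eNW y ∈ l.edges ∨ eSW y ∈ l.edges ∨ eSE y ∈ l.edges := by
  rw [eNE_mem_edges, eNW_mem_edges, eSW_mem_edges, eSE_mem_edges]
  by_cases h : y.2 < l.top.2
  · have := exists_next hy h; tauto
  · have := exists_prev hy (by have := l.bottom_height_lt_top; omega); tauto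

/-- Consecutive edges of a trace meet at one of its sites, the first reaching it from below and the
second from above. -/
theorem isChain_edges : l.edges.IsChain fun e₁ e₂ => ∃ y ∈ l.sites,
    (e₁ = eSW y ∨ e₁ = eSE y) ∧ (e₂ = eNE y ∨ e₂ = eNW y) := by
  rw [List.isChain_iff_getElem]
  intro i hi
  simp only [edges, List.length_zipWith, List.length_tail, List.getElem_zipWith,
    List.getElem_tail] at hi ⊢
  refine ⟨l.sites[i + 1], List.getElem_mem _, ?_, ?_⟩
  · have h := getElem_succ (l := l) (i := i) (by omega)
    rcases h with h | h
    · left; rw [h, eSW_ne]; rfl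
    · right; rw [h, eSE_nw]; rfl
  · have h := getElem_succ (l := l) (i := i + 1) (by omega)
    rcases h with h | h
    · left; rw [h]; rfl
    · right; rw [h]; rfl

end BrokenTrace

namespace BrokenTrace

variable {a b c d : ℤ} {k l : BrokenTrace}

/-! ### Crossing traces -/

/-- The sites of a trace in a rectangle, other than its endpoints, lie in the rectangle. -/
theorem isIn_site {y : Site} (hl : l.IsIn (rectangle a b c d)) (hy : y ∈ l.sites)
    (h₁ : l.bottom.2 < y.2) (h₂ : y.2 < l.top.2) : y ∈ rectangle a b c d := by
  have p := exists_prev hy h₁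
  have n := exists_next hy h₂
  have hp : sw y ∈ rectangle a b c d ∨ se y ∈ rectangle a b c d ∨ y ∈ rectangle a b c d := by
    rcases p with p | p
    · have := hl _ (eSW_mem_edges.2 ⟨hy, p⟩)
      rw [eSW_eq, eNE_mem_edgeSet] at this
      simp only [sw, ne, sub_add_cancel] at this ⊢; tauto
    · have := hl _ (eSE_mem_edges.2 ⟨hy, p⟩)
      rw [eSE_eq, eNW_mem_edgeSet] at this
      simp only [se, nw, sub_add_cancel, add_sub_cancel_right] at this ⊢; tauto
  have hn : ne y ∈ rectangle a b c d ∨ nw y ∈ rectangle a b c d ∨ y ∈ rectangle a b c d := by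
    rcases n with n | n
    · have := hl _ (eNE_mem_edges.2 ⟨hy, n⟩)
      rw [eNE_mem_edgeSet] at this; tauto
    · have := hl _ (eNW_mem_edges.2 ⟨hy, n⟩)
      rw [eNW_mem_edgeSet] at this; tauto
  simp only [mem_rectangle, sw, se, ne, nw] at hp hn ⊢
  omega

theorem bottom_eq_of_head? {p : Site → Prop} (h : ∃ y ∈ l.sites.head?, p y) : p l.bottom := by
  obtain ⟨y, hy, hp⟩ := h
  rw [Option.mem_def, List.head?_eq_getElem?, List.getElem?_eq_some_iff] at hy
  obtain ⟨_, rfl⟩ := hy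
  exact hp

theorem top_eq_of_getLast? {p : Site → Prop} (h : ∃ y ∈ l.sites.getLast?, p y) : p l.top := by
  obtain ⟨y, hy, hp⟩ := h
  rw [Option.mem_def, List.getLast?_eq_getElem?, List.getElem?_eq_some_iff] at hy
  obtain ⟨_, rfl⟩ := hy
  exact hp

theorem mem_crossing_iff {S : Set Site} :
    l ∈ crossing S ↔ l.IsIn S ∧ l.bottom ∈ outerBoundary S ∧ l.top ∈ outerBoundary S := by
  constructor
  · rintro ⟨h₁, h₂, h₃⟩
    exact ⟨h₁, bottom_eq_of_head? h₂, top_eq_of_getLast? h₃⟩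
  · rintro ⟨h₁, h₂, h₃⟩
    refine ⟨h₁, ⟨_, ?_, h₂⟩, ⟨_, ?_, h₃⟩⟩
    · rw [Option.mem_def, List.head?_eq_getElem?, List.getElem?_eq_some_iff]
      exact ⟨_, rfl⟩
    · rw [Option.mem_def, List.getLast?_eq_getElem?, List.getElem?_eq_some_iff]
      exact ⟨_, rfl⟩

/-- The lowest site of a trace in a rectangle lies in the rectangle, or on the southwest or the
southeast part of its outer boundary. -/
theorem bottom_cases (hl : l.IsIn (rectangle a b c d)) : l.bottom ∈ rectangle a b c d ∨
    (l.bottom.1 + l.bottom.2 = 2 * a - 2 ∧ 2 * c ≤ l.bottom.1 - l.bottom.2 ∧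
      l.bottom.1 - l.bottom.2 ≤ 2 * d) ∨
    (l.bottom.1 - l.bottom.2 = 2 * d + 2 ∧ 2 * a ≤ l.bottom.1 + l.bottom.2 ∧
      l.bottom.1 + l.bottom.2 ≤ 2 * b) := by
  rcases exists_next bottom_mem bottom_height_lt_top with n | n
  · have := hl _ (eNE_mem_edges.2 ⟨bottom_mem, n⟩)
    rw [eNE_mem_edgeSet] at this
    simp only [mem_rectangle, ne] at this ⊢
    omega
  · have := hl _ (eNW_mem_edges.2 ⟨bottom_mem, n⟩)
    rw [eNW_mem_edgeSet] at this
    simp only [mem_rectangle, nw] at this ⊢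
    omega

/-- The highest site of a trace in a rectangle lies in the rectangle, or on the northeast or the
northwest part of its outer boundary. -/
theorem top_cases (hl : l.IsIn (rectangle a b c d)) : l.top ∈ rectangle a b c d ∨
    (l.top.1 + l.top.2 = 2 * b + 2 ∧ 2 * c ≤ l.top.1 - l.top.2 ∧ l.top.1 - l.top.2 ≤ 2 * d) ∨
    (l.top.1 - l.top.2 = 2 * c - 2 ∧ 2 * a ≤ l.top.1 + l.top.2 ∧ l.top.1 + l.top.2 ≤ 2 * b) := by
  rcases exists_prev top_mem bottom_height_lt_top with n | n
  · have := hl _ (eSW_mem_edges.2 ⟨top_mem, n⟩)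
    rw [eSW_eq, eNE_mem_edgeSet] at this
    simp only [mem_rectangle, ne, sw] at this ⊢
    omega
  · have := hl _ (eSE_mem_edges.2 ⟨top_mem, n⟩)
    rw [eSE_eq, eNW_mem_edgeSet] at this
    simp only [mem_rectangle, nw, se] at this ⊢
    omega

theorem crossing_bottom (hl : l ∈ crossing (rectangle a b c d)) :
    l.bottom ∉ rectangle a b c d ∧
    ((l.bottom.1 + l.bottom.2 = 2 * a - 2 ∧ 2 * c ≤ l.bottom.1 - l.bottom.2 ∧
      l.bottom.1 - l.bottom.2 ≤ 2 * d) ∨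
    (l.bottom.1 - l.bottom.2 = 2 * d + 2 ∧ 2 * a ≤ l.bottom.1 + l.bottom.2 ∧
      l.bottom.1 + l.bottom.2 ≤ 2 * b)) := by
  rw [mem_crossing_iff] at hl
  exact ⟨hl.2.1.2, (bottom_cases hl.1).resolve_left hl.2.1.2⟩

theorem crossing_top (hl : l ∈ crossing (rectangle a b c d)) :
    l.top ∉ rectangle a b c d ∧
    ((l.top.1 + l.top.2 = 2 * b + 2 ∧ 2 * c ≤ l.top.1 - l.top.2 ∧ l.top.1 - l.top.2 ≤ 2 * d) ∨
    (l.top.1 - l.top.2 = 2 * c - 2 ∧ 2 * a ≤ l.top.1 + l.top.2 ∧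
      l.top.1 + l.top.2 ≤ 2 * b)) := by
  rw [mem_crossing_iff] at hl
  exact ⟨hl.2.2.2, (top_cases hl.1).resolve_left hl.2.2.2⟩

/-- A trace in a rectangle stays in the rectangle enlarged by one site on each side. -/
theorem site_bounds (hl : l.IsIn (rectangle a b c d)) {y : Site} (hy : y ∈ l.sites) :
    2 * a - 2 ≤ y.1 + y.2 ∧ y.1 + y.2 ≤ 2 * b + 2 ∧ 2 * c - 2 ≤ y.1 - y.2 ∧
      y.1 - y.2 ≤ 2 * d + 2 := by
  have hb := bottom_le hy
  have ht := le_top hy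
  rcases hb.eq_or_lt with h | h
  · obtain rfl := site_unique bottom_mem hy h
    have := bottom_cases hl
    have h1 := slope l.bottom_mem l.top_mem l.bottom_height_lt_top.le
    have h2 := top_cases hl
    simp only [mem_rectangle] at this h2
    omega
  rcases ht.eq_or_lt with h' | h'
  · obtain rfl := site_unique hy top_mem h'
    have := top_cases hl
    have h1 := slope l.bottom_mem l.top_mem l.bottom_height_lt_top.le
    have h2 := bottom_cases hl
    simp only [mem_rectangle] at this h2
    omega
  have := isIn_site hl hy h h'
  simp only [mem_rectangle] at this
  omega

end BrokenTrace

/-! ### The order of crossing traces -/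

/-- `f` lies in the open cone to the right of `y`: moving from `y` to `f`, both `t + x` and `t - x`
increase. -/
def IsRightOf (y f : Site) : Prop := y.1 + y.2 < f.1 + f.2 ∧ y.1 - y.2 < f.1 - f.2

namespace BrokenTrace

variable {a b c d : ℤ} {k l : BrokenTrace}

/-- A trace is never in the open right cone of one of its own sites. -/
theorem not_isRightOf_self {y z : Site} (hy : y ∈ l.sites) (hz : z ∈ l.sites) :
    ¬ IsRightOf y z := by
  rintro ⟨h₁, h₂⟩
  rcases le_total y.2 z.2 with h | h
  · have := slope hy hz h; omega
  · have := slope hz hy h; omega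

/-- If one crossing trace ends below the height where another one begins, they cut off opposite
corners of the rectangle, so that one is entirely to the left of the other. -/
theorem separated (hab : a ≤ b) (hcd : c ≤ d) (hk : k ∈ crossing (rectangle a b c d))
    (hl : l ∈ crossing (rectangle a b c d)) (h : l.top.2 < k.bottom.2) :
    (IsRightOf l.top k.bottom ∧ ∀ y ∈ l.sites, ∀ z ∈ k.sites, y.1 < z.1) ∨
    (IsRightOf k.bottom l.top ∧ ∀ y ∈ l.sites, ∀ z ∈ k.sites, z.1 < y.1) := by
  have hkb := (crossing_bottom hk).2
  have hlt := (crossing_top hl).2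
  have hkt : ∀ z ∈ k.sites, _ := fun z hz => slope bottom_mem hz (bottom_le hz)
  have hlb : ∀ y ∈ l.sites, _ := fun y hy => slope hy top_mem (le_top hy)
  have hkB : ∀ z ∈ k.sites, _ := fun z hz => site_bounds hk.1 hz
  have hlB : ∀ y ∈ l.sites, _ := fun y hy => site_bounds hl.1 hy
  rcases hkb with hkb | hkb <;> rcases hlt with hlt | hlt
  · right
    refine ⟨⟨by omega, by omega⟩, fun y hy z hz => ?_⟩
    have := hkt z hz; have := hlb y hy; have := hkB z hz; have := hlB y hy
    omega
  · omega
  · omega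
  · left
    refine ⟨⟨by omega, by omega⟩, fun y hy z hz => ?_⟩
    have := hkt z hz; have := hlb y hy; have := hkB z hz; have := hlB y hy
    omega

/-- If `k ≼ l` then no site of `k` is in the open right cone of a site of `l`. -/
theorem Le.not_isRightOf (hab : a ≤ b) (hcd : c ≤ d) (hk : k ∈ crossing (rectangle a b c d))
    (hl : l ∈ crossing (rectangle a b c d)) (hkl : k.Le l) {y z : Site} (hy : y ∈ l.sites)
    (hz : z ∈ k.sites) : ¬ IsRightOf y z := by
  rintro ⟨h₁, h₂⟩
  obtain ⟨hle, y₀, hy₀, z₀, hz₀, h₀⟩ := hkl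
  have by1 := site_bounds hl.1 hy
  have bz1 := site_bounds hk.1 hz
  have hkb := crossing_bottom hk
  have hlb := crossing_bottom hl
  have hkt := crossing_top hk
  have hlt := crossing_top hl
  rcases le_total y.2 z.2 with h | h
  · -- If `l` reaches the height of `z`, or `k` that of `y`, compare the traces at that height.
    rcases le_or_gt z.2 l.top.2 with h3 | h3
    · obtain ⟨w, hw, hw'⟩ := exists_site ((bottom_le hy).trans h) h3
      have := slope hy hw (by omega)
      have := hle z hz w hw hw'.symm
      omega
    rcases le_or_gt k.bottom.2 y.2 with h4 | h4
    · obtain ⟨w, hw, hw'⟩ := exists_site h4 (h.trans (le_top hz))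
      have := slope hw hz (by omega)
      have := hle w hw y hy hw'
      omega
    -- Now `k` begins above `y` and `l` ends below `z`. If `k` begins on the southwest side, `y` would
    -- be outside the bounds. If it begins on the southeast side, `l` has no room to the right of
    -- `k.bottom` at that height, or ends below it.
    have hs := slope bottom_mem hz (bottom_le hz)
    have hs' := slope hy top_mem (le_top hy)
    rcases hkb.2 with hb | hb
    · omega
    rcases le_or_gt k.bottom.2 l.top.2 with h5 | h5
    · obtain ⟨w, hw, hw'⟩ := exists_site ((bottom_le hy).trans h4.le) h5
      have := hle _ bottom_mem w hw hw'.symm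
      rcases h5.eq_or_lt with h6 | h6
      · obtain rfl := site_unique hw top_mem (hw'.trans h6)
        omega
      · have := isIn_site hl.1 hw (by have := bottom_le hy; omega) (by omega)
        rw [mem_rectangle] at this
        omega
    · rcases separated hab hcd hk hl h5 with ⟨-, h6⟩ | ⟨h6, -⟩
      · exact absurd h₀ (not_le.2 (h6 _ hz₀ _ hy₀))
      · unfold IsRightOf at h6; omega
  · -- The same argument upside down.
    rcases le_or_gt l.bottom.2 z.2 with h3 | h3
    · obtain ⟨w, hw, hw'⟩ := exists_site h3 (h.trans (le_top hy))
      have := slope hw hy (by omega)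
      have := hle z hz w hw hw'.symm
      omega
    rcases le_or_gt y.2 k.top.2 with h4 | h4
    · obtain ⟨w, hw, hw'⟩ := exists_site ((bottom_le hz).trans h) h4
      have := slope hz hw (by omega)
      have := hle w hw y hy hw'
      omega
    have hs := slope hz top_mem (le_top hz)
    have hs' := slope bottom_mem hy (bottom_le hy)
    rcases hkt.2 with hb | hb
    · rcases le_or_gt l.bottom.2 k.top.2 with h5 | h5
      · obtain ⟨w, hw, hw'⟩ := exists_site h5 (h4.le.trans (le_top hy))
        have := hle _ top_mem w hw hw'.symm
        rcases h5.eq_or_lt with h6 | h6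
        · obtain rfl := site_unique bottom_mem hw (h6.trans hw'.symm)
          omega
        · have := isIn_site hl.1 hw (by omega) (by have := le_top hy; omega)
          rw [mem_rectangle] at this
          omega
      · rcases separated hab hcd hl hk h5 with ⟨h6, -⟩ | ⟨-, h6⟩
        · unfold IsRightOf at h6; omega
        · exact absurd h₀ (not_le.2 (h6 _ hy₀ _ hz₀))
    · omega

/-- Two crossing traces such that neither has a site in the open right cone of a site of the other
coincide. -/
theorem eq_of_not_isRightOf (hab : a ≤ b) (hcd : c ≤ d) (hk : k ∈ crossing (rectangle a b c d))
    (hl : l ∈ crossing (rectangle a b c d))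
    (h₁ : ∀ y ∈ l.sites, ∀ z ∈ k.sites, ¬ IsRightOf y z)
    (h₂ : ∀ y ∈ l.sites, ∀ z ∈ k.sites, ¬ IsRightOf z y) : k = l := by
  have hkl : k.bottom.2 ≤ l.top.2 := by
    by_contra! h
    rcases separated hab hcd hk hl h with h' | h'
    · exact h₁ _ top_mem _ bottom_mem h'.1
    · exact h₂ _ top_mem _ bottom_mem h'.1
  have hlk : l.bottom.2 ≤ k.top.2 := by
    by_contra! h
    rcases separated hab hcd hl hk h with h' | h'
    · exact h₂ _ bottom_mem _ top_mem h'.1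
    · exact h₁ _ bottom_mem _ top_mem h'.1
  -- At a common height the two sites agree; a trace cannot continue beyond an end of the other one,
  -- since that end is outside the rectangle.
  have key : ∀ {k l : BrokenTrace}, k ∈ crossing (rectangle a b c d) →
      l ∈ crossing (rectangle a b c d) → k.bottom.2 ≤ l.top.2 → l.bottom.2 ≤ k.top.2 →
      (∀ y ∈ l.sites, ∀ z ∈ k.sites, ¬ IsRightOf y z) →
      (∀ y ∈ l.sites, ∀ z ∈ k.sites, ¬ IsRightOf z y) → k.sites ⊆ l.sites := by
    intro k l hk hl hkl hlk h₁ h₂ z hz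
    have agree : ∀ y ∈ l.sites, ∀ z ∈ k.sites, y.2 = z.2 → y = z := by
      intro y hy z hz h
      have := h₁ y hy z hz
      have := h₂ y hy z hz
      unfold IsRightOf at *
      ext <;> omega
    have hlt := crossing_top hl
    have hlb := crossing_bottom hl
    have hkt := crossing_top hk
    have hkb := crossing_bottom hk
    have hz1 := bottom_le hz
    have hz2 := le_top hz
    rcases lt_or_ge l.top.2 z.2 with h | h
    · obtain ⟨w, hw, hw'⟩ := exists_site hkl (by omega)
      obtain rfl := agree _ top_mem w hw hw'.symm
      rcases hkl.eq_or_lt with h' | h'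
      · have := site_unique bottom_mem hw h'
        rw [this] at hkb
        omega
      · exact absurd (isIn_site hk.1 hw h' (by omega)) hlt.1
    rcases lt_or_ge z.2 l.bottom.2 with h3 | h3
    · obtain ⟨w, hw, hw'⟩ := exists_site (x := l.bottom.2) (by omega) hlk
      obtain rfl := agree _ bottom_mem w hw hw'.symm
      rcases hlk.eq_or_lt with h' | h'
      · have := site_unique hw top_mem h'
        rw [← this] at hkt
        omega
      · exact absurd (isIn_site hk.1 hw (by omega) h') hlb.1
    obtain ⟨y, hy, hy'⟩ := exists_site h3 h
    rw [← agree y hy z hz hy']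
    exact hy
  exact ext_of_subset (key hk hl hkl hlk h₁ h₂)
    (key hl hk hlk hkl (fun y hy z hz => h₂ z hz y hy) (fun y hy z hz => h₁ z hz y hy))

theorem finite_isIn : {l : BrokenTrace | l.IsIn (rectangle a b c d)}.Finite := by
  have hbox : {y : Site | 2 * a - 2 ≤ y.1 + y.2 ∧ y.1 + y.2 ≤ 2 * b + 2 ∧ 2 * c - 2 ≤ y.1 - y.2 ∧
      y.1 - y.2 ≤ 2 * d + 2}.Finite := by
    apply ((Set.finite_Icc (a + c - 2) (b + d + 2)).prod
      (Set.finite_Icc (a - d - 2) (b - c + 2))).subset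
    intro y hy
    simp only [Set.mem_ofPred_eq] at hy
    simp only [Set.mem_prod, Set.mem_Icc]
    omega
  refine Set.Finite.of_finite_image (f := fun l => {y | y ∈ l.sites})
    (hbox.finite_subsets.subset ?_) ?_
  · rintro _ ⟨l, hl, rfl⟩ y hy
    exact site_bounds hl hy
  · intro k _ l _ h
    exact ext_of_subset (fun y hy => (Set.ext_iff.1 h y).1 hy) fun y hy => (Set.ext_iff.1 h y).2 hy

theorem finite_crossing : (crossing (rectangle a b c d)).Finite :=
  finite_isIn.subset fun _ h => h.1

end BrokenTrace

/-! ### Potentials and levels -/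

/-- `P` is a potential of the field `η` in `𝓔(S̄)`. It is a function on the faces of the lattice,
which are indexed by the sites `(t, x)` with `t + x` odd, so that `y = (t, x)` has the faces
`(t - 1, x)` and `(t + 1, x)` to its left and right, and `(t, x ± 1)` above and below it. The flow
through an edge is the difference of `P` between its right and its left face. The monotonicity is
also required outside the domain. -/
structure IsPotential (S : Set Site) (η : Edge → ℝ) (P : Site → ℝ) : Prop where
  mono : ∀ f g : Site, f.1 + f.2 ≤ g.1 + g.2 → f.1 - f.2 ≤ g.1 - g.2 → P f ≤ P g
  flow_ne : ∀ y, eNE y ∈ edgeSet S → η (eNE y) = P (y.1 + 1, y.2) - P (y.1, y.2 + 1)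
  flow_nw : ∀ y, eNW y ∈ edgeSet S → η (eNW y) = P (y.1, y.2 + 1) - P (y.1 - 1, y.2)

/-- The smaller value of `P` on the two faces that are separated by an edge; by monotonicity, it is
the value on the left face. -/
noncomputable def lowLevel (P : Site → ℝ) : Edge → ℝ :=
  Sym2.lift ⟨fun y z => min (P (y.1, z.2)) (P (z.1, y.2)), fun _ _ => min_comm _ _⟩

/-- The larger value of `P` on the two faces that are separated by an edge. -/
noncomputable def highLevel (P : Site → ℝ) : Edge → ℝ :=
  Sym2.lift ⟨fun y z => max (P (y.1, z.2)) (P (z.1, y.2)), fun _ _ => max_comm _ _⟩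

/-- The levels that all edges of the trace `l` have in common. -/
def levels (P : Site → ℝ) (l : BrokenTrace) : Set ℝ :=
  {h | ∀ e ∈ l.edges, h ∈ Set.Ioc (lowLevel P e) (highLevel P e)}

namespace IsPotential

variable {S : Set Site} {η : Edge → ℝ} {P : Site → ℝ}

theorem lowLevel_eNE (hP : IsPotential S η P) (y : Site) :
    lowLevel P (eNE y) = P (y.1, y.2 + 1) :=
  min_eq_left (hP.mono _ _ (by simp [ne]; omega) (by simp [ne]; omega))

theorem highLevel_eNE (hP : IsPotential S η P) (y : Site) :
    highLevel P (eNE y) = P (y.1 + 1, y.2) :=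
  max_eq_right (hP.mono _ _ (by simp [ne]; omega) (by simp [ne]; omega))

theorem lowLevel_eNW (hP : IsPotential S η P) (y : Site) :
    lowLevel P (eNW y) = P (y.1 - 1, y.2) :=
  min_eq_right (hP.mono _ _ (by simp [nw]; omega) (by simp [nw]; omega))

theorem highLevel_eNW (hP : IsPotential S η P) (y : Site) :
    highLevel P (eNW y) = P (y.1, y.2 + 1) :=
  max_eq_left (hP.mono _ _ (by simp [nw]; omega) (by simp [nw]; omega))

theorem lowLevel_eSW (hP : IsPotential S η P) (y : Site) :
    lowLevel P (eSW y) = P (y.1 - 1, y.2) := by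
  rw [eSW_eq, hP.lowLevel_eNE]; simp [sw]

theorem highLevel_eSW (hP : IsPotential S η P) (y : Site) :
    highLevel P (eSW y) = P (y.1, y.2 - 1) := by
  rw [eSW_eq, hP.highLevel_eNE]; simp [sw]

theorem lowLevel_eSE (hP : IsPotential S η P) (y : Site) :
    lowLevel P (eSE y) = P (y.1, y.2 - 1) := by
  rw [eSE_eq, hP.lowLevel_eNW]; simp [se]

theorem highLevel_eSE (hP : IsPotential S η P) (y : Site) :
    highLevel P (eSE y) = P (y.1 + 1, y.2) := by
  rw [eSE_eq, hP.highLevel_eNW]; simp [se]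

theorem flow_eq (hP : IsPotential S η P) {e : Edge} (he : e ∈ edgeSet S) :
    η e = highLevel P e - lowLevel P e := by
  obtain ⟨y, rfl | rfl⟩ := exists_eq_of_mem_edgeSet he
  · rw [hP.highLevel_eNE, hP.lowLevel_eNE, hP.flow_ne y he]
  · rw [hP.highLevel_eNW, hP.lowLevel_eNW, hP.flow_nw y he]

theorem flow_site (hP : IsPotential S η P) {y : Site} (hy : y ∈ S) :
    η (eNE y) = P (y.1 + 1, y.2) - P (y.1, y.2 + 1) ∧
    η (eNW y) = P (y.1, y.2 + 1) - P (y.1 - 1, y.2) ∧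
    η (eSE y) = P (y.1 + 1, y.2) - P (y.1, y.2 - 1) ∧
    η (eSW y) = P (y.1, y.2 - 1) - P (y.1 - 1, y.2) := by
  refine ⟨hP.flow_ne y (eNE_mem_edgeSet.2 (.inl hy)), hP.flow_nw y (eNW_mem_edgeSet.2 (.inl hy)),
    ?_, ?_⟩
  · rw [hP.flow_eq ⟨y, hy, by simp⟩, hP.highLevel_eSE, hP.lowLevel_eSE]
  · rw [hP.flow_eq ⟨y, hy, by simp⟩, hP.highLevel_eSW, hP.lowLevel_eSW]

/-- A field that has a potential satisfies the conservation law. -/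
theorem isFlowField (hP : IsPotential S η P) (h0 : ∀ e, e ∉ edgeSet S → η e = 0) :
    IsFlowField S η where
  nonneg e he := by
    obtain ⟨y, rfl | rfl⟩ := exists_eq_of_mem_edgeSet he
    · rw [hP.flow_ne y he, sub_nonneg]
      exact hP.mono _ _ (by simp; omega) (by simp; omega)
    · rw [hP.flow_nw y he, sub_nonneg]
      exact hP.mono _ _ (by simp; omega) (by simp; omega)
  conservation y hy := by
    obtain ⟨h1, h2, h3, h4⟩ := hP.flow_site hy
    rw [h1, h2, h3, h4]; ring
  eq_zero := h0

/-! ### Associated atoms have the same level -/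

/-- The level of an atom `(e, p)` is `lowLevel P e + p`. -/
theorem level_eq_of_atomAssoc (hP : IsPotential S η P) {e₁ e₂ : Edge} {p₁ p₂ : ℝ}
    (h : AtomAssoc S η e₁ p₁ e₂ p₂) : lowLevel P e₁ + p₁ = lowLevel P e₂ + p₂ := by
  obtain ⟨y, hy, h⟩ := h
  obtain ⟨h1, h2, h3, h4⟩ := hP.flow_site hy
  rcases h with ⟨rfl, rfl, -, rfl⟩ | ⟨rfl, rfl, -, rfl⟩ | ⟨rfl, rfl, -, rfl⟩ | ⟨rfl, rfl, -, -, h⟩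
  · rw [hP.lowLevel_eSW, hP.lowLevel_eNW]
  · rw [hP.lowLevel_eSE, hP.lowLevel_eNW]; linarith
  · rw [hP.lowLevel_eSW, hP.lowLevel_eNE]; linarith
  · rw [hP.lowLevel_eSE, hP.lowLevel_eNE]; linarith

/-- Conversely, atoms of the same level on two edges that meet at a site are associated: the
incoming edges, stacked from left to right, and the outgoing edges, stacked likewise, occupy the
same interval of levels. -/
theorem atomAssoc_of_level_eq (hP : IsPotential S η P) {y : Site} (hy : y ∈ S) {e₁ e₂ : Edge}
    (he₁ : e₁ = eSW y ∨ e₁ = eSE y) (he₂ : e₂ = eNE y ∨ e₂ = eNW y) {p₁ p₂ : ℝ}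
    (hp₁ : p₁ ∈ Set.Ioc 0 (η e₁)) (hp₂ : p₂ ∈ Set.Ioc 0 (η e₂))
    (h : lowLevel P e₁ + p₁ = lowLevel P e₂ + p₂) : AtomAssoc S η e₁ p₁ e₂ p₂ := by
  refine ⟨y, hy, ?_⟩
  obtain ⟨h1, h2, h3, h4⟩ := hP.flow_site hy
  obtain ⟨hp, hp'⟩ := hp₁
  obtain ⟨hq, hq'⟩ := hp₂
  rcases he₁ with rfl | rfl <;> rcases he₂ with rfl | rfl
  · rw [hP.lowLevel_eSW, hP.lowLevel_eNE] at h
    exact .inr (.inr (.inl ⟨rfl, rfl, ⟨by linarith, hp'⟩, by linarith⟩))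
  · rw [hP.lowLevel_eSW, hP.lowLevel_eNW] at h
    exact .inl ⟨rfl, rfl, ⟨hp, le_min hp' (by linarith)⟩, by linarith⟩
  · rw [hP.lowLevel_eSE, hP.lowLevel_eNE] at h
    refine .inr (.inr (.inr ⟨rfl, rfl, ⟨?_, hp'⟩, ⟨?_, hq'⟩, by linarith⟩))
    all_goals
      have : η (eSE y) - p₁ < birthAt η y := lt_min (by linarith) (by linarith)
      linarith
  · rw [hP.lowLevel_eSE, hP.lowLevel_eNW] at h
    exact .inr (.inl ⟨rfl, rfl, ⟨by linarith, hq'⟩, by linarith⟩)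

end IsPotential

/-! ### The weight of a trace is the length of its set of levels -/

theorem exists_levels_eq_Ioc (P : Site → ℝ) (l : BrokenTrace) :
    ∃ A B : ℝ, levels P l = Set.Ioc A B := by
  have key : ∀ L : List Edge, L ≠ [] →
      ∃ A B : ℝ, {h | ∀ e ∈ L, h ∈ Set.Ioc (lowLevel P e) (highLevel P e)} = Set.Ioc A B := by
    intro L
    induction L with
    | nil => simp
    | cons e L ih =>
      intro _
      rcases eq_or_ne L [] with rfl | hL
      · exact ⟨lowLevel P e, highLevel P e, by ext; simp⟩
      · obtain ⟨A, B, hAB⟩ := ih hL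
        refine ⟨lowLevel P e ⊔ A, highLevel P e ⊓ B, ?_⟩
        rw [← Set.Ioc_inter_Ioc, ← hAB]
        ext h
        simp only [List.forall_mem_cons]
        rfl
  exact key _ l.edges_ne_nil

theorem measurableSet_levels (P : Site → ℝ) (l : BrokenTrace) : MeasurableSet (levels P l) := by
  obtain ⟨A, B, h⟩ := exists_levels_eq_Ioc P l
  rw [h]; exact measurableSet_Ioc

theorem levels_finite_measure (P : Site → ℝ) (l : BrokenTrace) :
    MeasureTheory.volume (levels P l) ≠ ⊤ := by
  obtain ⟨A, B, h⟩ := exists_levels_eq_Ioc P l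
  rw [h]; exact measure_Ioc_lt_top.ne

/-- Associated strands consist of the same levels. -/
theorem level_mem_iff_of_strandAssoc {S : Set Site} {η : Edge → ℝ} {P : Site → ℝ}
    (hP : IsPotential S η P) {s₁ s₂ : Strand} (h : StrandAssoc S η s₁ s₂) (r : ℝ) :
    r - lowLevel P s₁.1 ∈ s₁.interval ↔ r - lowLevel P s₂.1 ∈ s₂.interval := by
  constructor
  · intro hr
    obtain ⟨p, hp, hp'⟩ := h.1 _ hr
    have := hP.level_eq_of_atomAssoc hp'
    rwa [show r - lowLevel P s₂.1 = p by linarith]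
  · intro hr
    obtain ⟨p, hp, hp'⟩ := h.2 _ hr
    have := hP.level_eq_of_atomAssoc hp'
    rwa [show r - lowLevel P s₁.1 = p by linarith]

theorem level_mem_iff_of_isChain {S : Set Site} {η : Edge → ℝ} {P : Site → ℝ}
    (hP : IsPotential S η P) {s : Strand} {L : List Strand}
    (h : (s :: L).IsChain (StrandAssoc S η)) (r : ℝ) :
    ∀ s' ∈ L, (r - lowLevel P s.1 ∈ s.interval ↔ r - lowLevel P s'.1 ∈ s'.interval) := by
  induction L generalizing s with
  | nil => simp
  | cons s₁ L ih =>
    rw [List.isChain_cons_cons] at h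
    have h₁ := level_mem_iff_of_strandAssoc hP h.1 r
    intro s' hs'
    rcases List.mem_cons.1 hs' with rfl | hs'
    · exact h₁
    · exact h₁.trans (ih h.2 s' hs')

/-- The maximal broken line with trace `l` consists of all levels that the edges of `l` have in
common. -/
theorem traceWeight_eq_volume {a b c d : ℤ} {η : Edge → ℝ} {P : Site → ℝ}
    (hP : IsPotential (rectangle a b c d) η P) {l : BrokenTrace}
    (hl : l.IsIn (rectangle a b c d)) :
    traceWeight (rectangle a b c d) η l = MeasureTheory.volume.real (levels P l) := by
  obtain ⟨A, B, hAB⟩ := exists_levels_eq_Ioc P l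
  have hvol : MeasureTheory.volume.real (levels P l) = max (B - A) 0 := by
    rw [hAB, Real.volume_real_Ioc]
  rw [hvol]
  apply IsGreatest.csSup_eq
  constructor
  · -- The levels of `l` form a broken line.
    let f : Edge → Strand := fun e => (e, (A - lowLevel P e, B - lowLevel P e))
    have hmem : ∀ e p, p ∈ (f e).interval ↔ p + lowLevel P e ∈ Set.Ioc A B := by
      intro e p
      simp only [f, Strand.interval, Set.mem_Ioc, sub_lt_iff_lt_add, le_sub_iff_add_le]
    have hsub : ∀ e ∈ l.edges, (f e).interval ⊆ Set.Ioc 0 (η e) := by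
      intro e he p hp
      rw [hmem, ← hAB] at hp
      have := hp e he
      rw [hP.flow_eq (hl e he)]
      constructor <;> linarith [this.1, this.2]
    refine ⟨⟨l, l.edges.map f, ?_, ?_⟩, ⟨hl, ?_, ?_⟩, rfl, ?_⟩
    · rw [List.map_map]; exact List.map_id _
    · intro s hs s' hs'
      obtain ⟨e, -, rfl⟩ := List.mem_map.1 hs
      obtain ⟨e', -, rfl⟩ := List.mem_map.1 hs'
      simp [f, Strand.width]
    · intro s hs
      obtain ⟨e, he, rfl⟩ := List.mem_map.1 hs
      exact hsub e he
    · rw [List.isChain_map, List.isChain_iff_getElem]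
      intro i hi
      have h₁ : l.edges[i] ∈ l.edges := List.getElem_mem _
      have h₂ : l.edges[i + 1] ∈ l.edges := List.getElem_mem _
      obtain ⟨y, hy, hy₁, hy₂⟩ := List.isChain_iff_getElem.1 l.isChain_edges i hi
      have hyS : y ∈ rectangle a b c d := by
        apply BrokenTrace.isIn_site hl hy
        · rcases hy₁ with h | h
          · rw [h, BrokenTrace.eSW_mem_edges] at h₁
            have := BrokenTrace.bottom_le h₁.2
            simp only [sw] at this; omega
          · rw [h, BrokenTrace.eSE_mem_edges] at h₁
            have := BrokenTrace.bottom_le h₁.2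
            simp only [se] at this; omega
        · rcases hy₂ with h | h
          · rw [h, BrokenTrace.eNE_mem_edges] at h₂
            have := BrokenTrace.le_top h₂.2
            simp only [ne] at this; omega
          · rw [h, BrokenTrace.eNW_mem_edges] at h₂
            have := BrokenTrace.le_top h₂.2
            simp only [nw] at this; omega
      constructor
      · intro p hp
        have hq : p + lowLevel P l.edges[i] - lowLevel P l.edges[i + 1] ∈
            (f l.edges[i + 1]).interval := by
          rw [hmem] at hp ⊢; simpa using hp
        exact ⟨_, hq, hP.atomAssoc_of_level_eq hyS hy₁ hy₂ (hsub _ h₁ hp) (hsub _ h₂ hq)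
          (by ring)⟩
      · intro p hp
        have hq : p + lowLevel P l.edges[i + 1] - lowLevel P l.edges[i] ∈
            (f l.edges[i]).interval := by
          rw [hmem] at hp ⊢; simpa using hp
        exact ⟨_, hq, hP.atomAssoc_of_level_eq hyS hy₁ hy₂ (hsub _ h₁ hq) (hsub _ h₂ hp)
          (by ring)⟩
    · obtain ⟨e, L, hL⟩ := List.exists_cons_of_ne_nil l.edges_ne_nil
      simp [BrokenLine.weight, hL, f, Strand.width]
  · -- All strands of a broken line consist of the same levels, and these are levels of `l`.
    rintro _ ⟨⟨l, L, hL, hw⟩, ⟨hl, hsub, hchain⟩, rfl, rfl⟩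
    simp only at hL hl hsub hchain hAB
    cases L with
    | nil => exact absurd hL.symm l.edges_ne_nil
    | cons s L =>
      have hle : Set.Ioc (s.2.1 + lowLevel P s.1) (s.2.2 + lowLevel P s.1) ⊆ Set.Ioc A B := by
        intro r hr
        have hr : r - lowLevel P s.1 ∈ s.interval :=
          ⟨lt_sub_iff_add_lt.2 hr.1, sub_le_iff_le_add.2 hr.2⟩
        rw [← hAB]
        intro e he
        rw [← hL] at he
        obtain ⟨s', hs', rfl⟩ := List.mem_map.1 he
        have hr' : r - lowLevel P s'.1 ∈ Strand.interval s' := by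
          rcases List.mem_cons.1 hs' with rfl | h
          · exact hr
          · exact (level_mem_iff_of_isChain hP hchain r s' h).1 hr
        have := hsub s' hs' hr'
        have he' : s'.1 ∈ edgeSet (rectangle a b c d) := hl _ (hL ▸ he)
        rw [hP.flow_eq he'] at this
        constructor <;> linarith [this.1, this.2]
      change max (s.2.2 - s.2.1) 0 ≤ _
      rcases le_or_gt s.2.2 s.2.1 with h | h
      · rw [max_eq_right (by linarith)]; exact le_max_right _ _
      · rw [Set.Ioc_subset_Ioc_iff (by linarith)] at hle
        exact max_le_max (by linarith [hle.1, hle.2]) le_rfl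

/-! ### Every flow field has a potential -/

section potential

variable (a b c d : ℤ) (η : Edge → ℝ)

/-- The site with `t + x = 2a + 2i` and `t - x = 2c + 2j`. -/
def gridSite (i j : ℕ) : Site := (a + c + i + j, a - c + i - j)

/-- The potential of `η` in the coordinates of `gridSite`: the flow that crosses a path of faces
which starts at the leftmost face, follows the southwest side of the rectangle for `j` steps, and
then makes `i` steps parallel to the southeast side. -/
noncomputable def gridPotential (i j : ℕ) : ℝ :=
  ∑ j' ∈ Finset.range j, η (eSW (gridSite a c 0 j')) +
    ∑ i' ∈ Finset.range i, η (eNW (gridSite a c i' j))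

/-- The potential of the flow field `η`, extended from the faces of the rectangle to all faces by
projection. -/
noncomputable def potential (f : Site) : ℝ :=
  gridPotential a c η (min ((f.1 + f.2 - 2 * a + 1) / 2).toNat (b - a + 1).toNat)
    (min ((f.1 - f.2 - 2 * c + 1) / 2).toNat (d - c + 1).toNat)

variable {a b c d η}

theorem gridPotential_succ_left (i j : ℕ) : gridPotential a c η (i + 1) j =
    gridPotential a c η i j + η (eNW (gridSite a c i j)) := by
  simp only [gridPotential, Finset.sum_range_succ]; ring

/-- By the conservation law, the flow across a path of faces does not depend on the path: a step in
the second direction may be taken last. -/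
theorem gridPotential_succ_right (hη : IsFlowField (rectangle a b c d) η) {i j : ℕ}
    (hi : (i : ℤ) ≤ b - a + 1) (hj : (j : ℤ) ≤ d - c) :
    gridPotential a c η i (j + 1) = gridPotential a c η i j + η (eSW (gridSite a c i j)) := by
  induction i with
  | zero => simp [gridPotential, Finset.sum_range_succ]
  | succ i ih =>
    have ih := ih (by push_cast at hi; omega)
    have hS : gridSite a c i j ∈ rectangle a b c d := by
      rw [mem_rectangle]; simp only [gridSite]; push_cast at hi; omega
    have h := hη.conservation _ hS
    have e₁ : eNW (gridSite a c i (j + 1)) = eSE (gridSite a c i j) := by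
      rw [eSE_eq]; congr 1; ext <;> simp [gridSite, se] <;> ring
    have e₂ : eSW (gridSite a c (i + 1) j) = eNE (gridSite a c i j) := by
      rw [← eSW_ne]; congr 1; ext <;> simp [gridSite, ne] <;> ring
    rw [gridPotential_succ_left, gridPotential_succ_left, e₁, e₂, ih]
    linarith

theorem isPotential_potential (hη : IsFlowField (rectangle a b c d) η) :
    IsPotential (rectangle a b c d) η (potential a b c d η) := by
  have hpos : ∀ e, 0 ≤ η e := fun e => by
    by_cases he : e ∈ edgeSet (rectangle a b c d)
    · exact hη.nonneg e he
    · exact (hη.eq_zero e he).ge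
  refine ⟨fun f g h₁ h₂ => ?_, fun y hy => ?_, fun y hy => ?_⟩
  · have left : ∀ i i' j : ℕ, i ≤ i' → gridPotential a c η i j ≤ gridPotential a c η i' j := by
      intro i i' j h
      induction i', h using Nat.le_induction with
      | base => rfl
      | succ i' _ ih => rw [gridPotential_succ_left]; linarith [hpos (eNW (gridSite a c i' j))]
    have right : ∀ i j j' : ℕ, (i : ℤ) ≤ b - a + 1 → j ≤ j' → (j : ℤ) = j' ∨ (j' : ℤ) ≤ d - c + 1 →
        gridPotential a c η i j ≤ gridPotential a c η i j' := by
      intro i j j' hi h hj'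
      induction j', h using Nat.le_induction with
      | base => rfl
      | succ j' hj ih =>
        push_cast at hj'
        rw [gridPotential_succ_right hη hi (by omega)]
        linarith [hpos (eSW (gridSite a c i j')), ih (by omega)]
    have hi : ((f.1 + f.2 - 2 * a + 1) / 2).toNat ≤ ((g.1 + g.2 - 2 * a + 1) / 2).toNat := by omega
    have hj : ((f.1 - f.2 - 2 * c + 1) / 2).toNat ≤ ((g.1 - g.2 - 2 * c + 1) / 2).toNat := by omega
    rcases lt_or_ge (b - a + 1) 0 with hab | hab
    · -- If the rectangle is empty, so is the flow.
      have h0 : ∀ e, η e = 0 := fun e => hη.eq_zero e fun ⟨y, hy, _⟩ => by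
        rw [mem_rectangle] at hy; omega
      simp [potential, gridPotential, h0]
    · exact (left _ _ _ (min_le_min_right _ hi)).trans
        (right _ _ _ (by omega) (min_le_min_right _ hj) (by omega))
  · have hy := eNE_mem_edgeSet.1 hy
    simp only [mem_rectangle, ne] at hy
    obtain ⟨i, hi⟩ : ∃ i : ℕ, (i : ℤ) = (y.1 + y.2 + 2 - 2 * a) / 2 :=
      ⟨((y.1 + y.2 + 2 - 2 * a) / 2).toNat, by omega⟩
    obtain ⟨j, hj⟩ : ∃ j : ℕ, (j : ℤ) = (y.1 - y.2 - 2 * c) / 2 :=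
      ⟨((y.1 - y.2 - 2 * c) / 2).toNat, by omega⟩
    have e : eNE y = eSW (gridSite a c i j) := by
      rw [← eSW_ne]; congr 1
      ext <;> simp only [gridSite, ne] <;> omega
    have h := gridPotential_succ_right hη (i := i) (j := j) (by omega) (by omega)
    have r : potential a b c d η (y.1 + 1, y.2) = gridPotential a c η i (j + 1) := by
      unfold potential; congr 1 <;> dsimp only <;> omega
    have l : potential a b c d η (y.1, y.2 + 1) = gridPotential a c η i j := by
      unfold potential; congr 1 <;> dsimp only <;> omega
    rw [e, r, l, h]; ring
  · have hy := eNW_mem_edgeSet.1 hy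
    simp only [mem_rectangle, nw] at hy
    obtain ⟨i, hi⟩ : ∃ i : ℕ, (i : ℤ) = (y.1 + y.2 - 2 * a) / 2 :=
      ⟨((y.1 + y.2 - 2 * a) / 2).toNat, by omega⟩
    obtain ⟨j, hj⟩ : ∃ j : ℕ, (j : ℤ) = (y.1 - y.2 - 2 * c) / 2 :=
      ⟨((y.1 - y.2 - 2 * c) / 2).toNat, by omega⟩
    have e : eNW y = eNW (gridSite a c i j) := by
      congr 1
      ext <;> simp only [gridSite] <;> omega
    have h := gridPotential_succ_left (a := a) (c := c) (η := η) i j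
    have r : potential a b c d η (y.1, y.2 + 1) = gridPotential a c η (i + 1) j := by
      unfold potential; congr 1 <;> dsimp only <;> omega
    have l : potential a b c d η (y.1 - 1, y.2) = gridPotential a c η i j := by
      unfold potential; congr 1 <;> dsimp only <;> omega
    rw [e, r, l, h]; ring

end potential

/-! ### The crossing trace at a given level -/

variable {a b c d : ℤ} {η : Edge → ℝ} {P : Site → ℝ} {k l : BrokenTrace} {h : ℝ}

theorem levels_antitone (hkl : k.IsPartOf l) : levels P l ⊆ levels P k :=
  fun _ hr e he => hr e (hkl.edges_subset he)

theorem IsPotential.level_mem_Ioc {S : Set Site} (hP : IsPotential S η P) (hh : h ∈ levels P l)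
    {y : Site} (hy : y ∈ l.sites) : h ∈ Set.Ioc (P (y.1 - 1, y.2)) (P (y.1 + 1, y.2)) := by
  rcases BrokenTrace.exists_edge hy with e | e | e | e <;> have := hh _ e
  · rw [hP.lowLevel_eNE, hP.highLevel_eNE] at this
    exact ⟨(hP.mono _ _ (by dsimp only; omega) (by dsimp only; omega)).trans_lt this.1, this.2⟩
  · rw [hP.lowLevel_eNW, hP.highLevel_eNW] at this
    exact ⟨this.1, this.2.trans (hP.mono _ _ (by dsimp only; omega) (by dsimp only; omega))⟩
  · rw [hP.lowLevel_eSW, hP.highLevel_eSW] at this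
    exact ⟨this.1, this.2.trans (hP.mono _ _ (by dsimp only; omega) (by dsimp only; omega))⟩
  · rw [hP.lowLevel_eSE, hP.highLevel_eSE] at this
    exact ⟨(hP.mono _ _ (by dsimp only; omega) (by dsimp only; omega)).trans_lt this.1, this.2⟩

/-- A trace at level `h` has no site in the open right cone of a site of a trace at a higher
level. -/
theorem IsPotential.not_isRightOf {S : Set Site} (hP : IsPotential S η P) {h' : ℝ}
    (hh : h ∈ levels P k) (hh' : h' ∈ levels P l) (hle : h ≤ h') {y z : Site} (hy : y ∈ l.sites)
    (hz : z ∈ k.sites) : ¬ IsRightOf y z := by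
  rintro ⟨h₁, h₂⟩
  have p₁ := mem_evenLattice_iff.1 (l.mem_evenLattice y hy)
  have p₂ := mem_evenLattice_iff.1 (k.mem_evenLattice z hz)
  have hy' := (hP.level_mem_Ioc hh' hy).2
  have hz' := (hP.level_mem_Ioc hh hz).1
  have := hP.mono (y.1 + 1, y.2) (z.1 - 1, z.2) (by dsimp only; omega) (by dsimp only; omega)
  linarith

/-- There is at most one crossing trace at each level. -/
theorem IsPotential.crossing_unique (hab : a ≤ b) (hcd : c ≤ d)
    (hP : IsPotential (rectangle a b c d) η P)
    (hk : k ∈ BrokenTrace.crossing (rectangle a b c d))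
    (hl : l ∈ BrokenTrace.crossing (rectangle a b c d))
    (hhk : h ∈ levels P k) (hhl : h ∈ levels P l) : k = l :=
  BrokenTrace.eq_of_not_isRightOf hab hcd hk hl
    (fun _ hy _ hz => hP.not_isRightOf hhk hhl le_rfl hy hz)
    (fun _ hy _ hz => hP.not_isRightOf hhl hhk le_rfl hz hy)

/-- Crossing traces at increasing levels are ordered from left to right. -/
theorem IsPotential.le_of_levels (hab : a ≤ b) (hcd : c ≤ d)
    (hP : IsPotential (rectangle a b c d) η P)
    (hk : k ∈ BrokenTrace.crossing (rectangle a b c d))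
    (hl : l ∈ BrokenTrace.crossing (rectangle a b c d)) {h' : ℝ}
    (hh : h ∈ levels P k) (hh' : h' ∈ levels P l) (hle : h ≤ h') : k.Le l := by
  have common : ∀ z ∈ k.sites, ∀ y ∈ l.sites, z.2 = y.2 → z.1 ≤ y.1 := by
    intro z hz y hy hzy
    by_contra! hlt
    exact hP.not_isRightOf hh hh' hle hy hz ⟨by omega, by omega⟩
  refine ⟨common, ?_⟩
  rcases lt_or_ge l.top.2 k.bottom.2 with h₁ | h₁
  · rcases BrokenTrace.separated hab hcd hk hl h₁ with ⟨h₂, -⟩ | ⟨-, h₂⟩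
    · exact absurd h₂ (hP.not_isRightOf hh hh' hle BrokenTrace.top_mem BrokenTrace.bottom_mem)
    · exact ⟨_, k.bottom_mem, _, l.bottom_mem, (h₂ _ l.bottom_mem _ k.bottom_mem).le⟩
  rcases lt_or_ge k.top.2 l.bottom.2 with h₃ | h₃
  · rcases BrokenTrace.separated hab hcd hl hk h₃ with ⟨-, h₂⟩ | ⟨h₂, -⟩
    · exact ⟨_, k.bottom_mem, _, l.bottom_mem, (h₂ _ k.bottom_mem _ l.bottom_mem).le⟩
    · exact absurd h₂ (hP.not_isRightOf hh hh' hle BrokenTrace.bottom_mem BrokenTrace.top_mem)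
  have hk' := k.bottom_height_lt_top
  have hl' := l.bottom_height_lt_top
  obtain ⟨z, hz, hz'⟩ := k.exists_site (x := max k.bottom.2 l.bottom.2) (by omega) (by omega)
  obtain ⟨y, hy, hy'⟩ := l.exists_site (x := max k.bottom.2 l.bottom.2) (by omega) (by omega)
  exact ⟨z, hz, y, hy, common z hz y hy (hz'.trans hy'.symm)⟩

/-- The trace `l` continued upwards by the site `z`. -/
def BrokenTrace.append (l : BrokenTrace) (z : Site) (hz : z = ne l.top ∨ z = nw l.top) :
    BrokenTrace where
  sites := l.sites ++ [z]
  two_le_length := by have := l.two_le_length; simp; omega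
  mem_evenLattice := by
    have := mem_evenLattice_iff.1 (l.mem_evenLattice _ l.top_mem)
    intro y hy
    rcases List.mem_append.1 hy with hy | hy
    · exact l.mem_evenLattice y hy
    · rw [List.mem_singleton.1 hy, mem_evenLattice_iff]
      rcases hz with rfl | rfl <;> simp only [ne, nw] <;> omega
  isChain := by
    rw [List.isChain_append]
    refine ⟨l.isChain, by simp, ?_⟩
    intro x hx y hy
    rw [List.head?_singleton, Option.mem_def, Option.some.injEq] at hy
    rw [Option.mem_def, List.getLast?_eq_getElem?, List.getElem?_eq_some_iff] at hx
    obtain ⟨_, rfl⟩ := hx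
    subst hy
    exact hz

/-- The trace `l` continued downwards by the site `z`. -/
def BrokenTrace.cons (l : BrokenTrace) (z : Site) (hz : z = sw l.bottom ∨ z = se l.bottom) :
    BrokenTrace where
  sites := z :: l.sites
  two_le_length := by have := l.two_le_length; simp; omega
  mem_evenLattice := by
    have := mem_evenLattice_iff.1 (l.mem_evenLattice _ l.bottom_mem)
    intro y hy
    rcases List.mem_cons.1 hy with rfl | hy
    · rw [mem_evenLattice_iff]
      rcases hz with rfl | rfl <;> simp only [sw, se] <;> omega
    · exact l.mem_evenLattice y hy
  isChain := by
    rw [List.isChain_cons]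
    refine ⟨?_, l.isChain⟩
    intro y hy
    rw [Option.mem_def, List.head?_eq_getElem?, List.getElem?_eq_some_iff] at hy
    obtain ⟨_, rfl⟩ := hy
    change l.bottom = _ ∨ l.bottom = _
    rcases hz with rfl | rfl <;> simp [ne, nw, sw, se]

theorem BrokenTrace.mem_edges_append {z : Site} {hz : z = ne l.top ∨ z = nw l.top} {e : Edge}
    (he : e ∈ (l.append z hz).edges) : e ∈ l.edges ∨ e = s(l.top, z) := by
  have h0 : (l.append z hz).sites = l.sites ++ [z] := rfl
  have ht : z.2 = l.top.2 + 1 := by rcases hz with rfl | rfl <;> rfl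
  rw [mem_edges] at he ⊢
  simp only [h0, List.mem_append, List.mem_singleton] at he
  obtain ⟨y, hy | rfl, h⟩ := he
  · have key : ∀ w : Site, w.2 = y.2 + 1 → w = z → y = l.top := by
      rintro w hw rfl; exact site_unique hy l.top_mem (by omega)
    rcases h with ⟨h | h, rfl⟩ | ⟨h | h, rfl⟩
    · exact .inl ⟨y, hy, .inl ⟨h, rfl⟩⟩
    · right; rw [← h, ← key _ rfl h]; rfl
    · exact .inl ⟨y, hy, .inr ⟨h, rfl⟩⟩
    · right; rw [← h, ← key _ rfl h]; rfl
  · -- The new site is the highest one.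
    have key : ∀ w : Site, w.2 = y.2 + 1 → ¬ (w ∈ l.sites ∨ w = y) := by
      rintro w hw (h | rfl)
      · have := le_top h; omega
      · omega
    rcases h with ⟨h, -⟩ | ⟨h, -⟩
    · exact absurd h (key _ rfl)
    · exact absurd h (key _ rfl)

theorem BrokenTrace.mem_edges_cons {z : Site} {hz : z = sw l.bottom ∨ z = se l.bottom} {e : Edge}
    (he : e ∈ (l.cons z hz).edges) : e ∈ l.edges ∨ e = s(l.bottom, z) := by
  have h0 : (l.cons z hz).sites = z :: l.sites := rfl
  have ht : z.2 = l.bottom.2 - 1 := by rcases hz with rfl | rfl <;> rfl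
  rw [mem_edges] at he ⊢
  simp only [h0, List.mem_cons] at he
  obtain ⟨y, rfl | hy, h⟩ := he
  · have key : ∀ w : Site, w.2 = y.2 + 1 → (w = y ∨ w ∈ l.sites) → w = l.bottom := by
      rintro w hw (rfl | h)
      · omega
      · exact site_unique h l.bottom_mem (by omega)
    rcases h with ⟨h, rfl⟩ | ⟨h, rfl⟩
    · right; rw [← key _ rfl h]; exact Sym2.eq_swap
    · right; rw [← key _ rfl h]; exact Sym2.eq_swap
  · -- The new site is below all others.
    have key : ∀ w : Site, w.2 = y.2 + 1 → w ≠ z := by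
      rintro w hw rfl; have := bottom_le hy; omega
    rcases h with ⟨h | h, rfl⟩ | ⟨h | h, rfl⟩
    · exact absurd h (key _ rfl)
    · exact .inl ⟨y, hy, .inl ⟨h, rfl⟩⟩
    · exact absurd h (key _ rfl)
    · exact .inl ⟨y, hy, .inr ⟨h, rfl⟩⟩

/-- Every trace at level `h` is part of a crossing trace at level `h`: a trace of maximal length at
level `h` crosses, because at an end inside `S` it could be continued along the edge that carries
the level `h` on. -/
theorem IsPotential.exists_crossing (hP : IsPotential (rectangle a b c d) η P)
    (hl : l.IsIn (rectangle a b c d)) (hh : h ∈ levels P l) :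
    ∃ k ∈ BrokenTrace.crossing (rectangle a b c d), l.IsPartOf k ∧ h ∈ levels P k := by
  have hfin : {k : BrokenTrace | k.IsIn (rectangle a b c d) ∧ l.IsPartOf k ∧
      h ∈ levels P k}.Finite := BrokenTrace.finite_isIn.subset fun k hk => hk.1
  obtain ⟨k, ⟨hk, hlk, hhk⟩, hmax⟩ := hfin.exists_maximalFor (fun k => k.sites.length) _
    ⟨l, hl, List.infix_rfl, hh⟩
  refine ⟨k, BrokenTrace.mem_crossing_iff.2 ⟨hk, ?_, ?_⟩, hlk, hhk⟩
  · have hbot : k.bottom ∉ rectangle a b c d := by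
      intro hS
      obtain ⟨z, hz, hzS, hzh⟩ : ∃ z, (z = sw k.bottom ∨ z = se k.bottom) ∧
          s(k.bottom, z) ∈ edgeSet (rectangle a b c d) ∧
          h ∈ Set.Ioc (lowLevel P s(k.bottom, z)) (highLevel P s(k.bottom, z)) := by
        have hb := hP.level_mem_Ioc hhk k.bottom_mem
        rcases le_or_gt h (P (k.bottom.1, k.bottom.2 - 1)) with h₁ | h₁
        · refine ⟨_, .inl rfl, ⟨_, hS, by simp [eSW]⟩, ?_⟩
          have h₂ := hP.lowLevel_eSW k.bottom
          have h₃ := hP.highLevel_eSW k.bottom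
          rw [eSW] at h₂ h₃
          rw [h₂, h₃]; exact ⟨hb.1, h₁⟩
        · refine ⟨_, .inr rfl, ⟨_, hS, by simp [eSE]⟩, ?_⟩
          have h₂ := hP.lowLevel_eSE k.bottom
          have h₃ := hP.highLevel_eSE k.bottom
          rw [eSE] at h₂ h₃
          rw [h₂, h₃]; exact ⟨h₁, hb.2⟩
      have hpart : k.IsPartOf (k.cons z hz) := (List.suffix_cons z k.sites).isInfix
      have hlen : (k.cons z hz).sites.length = k.sites.length + 1 := List.length_cons
      have := hmax (j := k.cons z hz) ⟨fun e he => ?_, hlk.trans hpart, fun e he => ?_⟩ (by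
        simp only [hlen]; omega)
      · simp only [hlen] at this; omega
      · rcases BrokenTrace.mem_edges_cons he with he | rfl
        exacts [hk e he, hzS]
      · rcases BrokenTrace.mem_edges_cons he with he | rfl
        exacts [hhk e he, hzh]
    refine mem_outerBoundary_of_adjacent rectangle_subset_evenLattice hbot ?_
    rcases BrokenTrace.exists_next k.bottom_mem k.bottom_height_lt_top with n | n
    · have := hk _ (BrokenTrace.eNE_mem_edges.2 ⟨k.bottom_mem, n⟩)
      rw [eNE_mem_edgeSet] at this; tauto
    · have := hk _ (BrokenTrace.eNW_mem_edges.2 ⟨k.bottom_mem, n⟩)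
      rw [eNW_mem_edgeSet] at this; tauto
  · have htop : k.top ∉ rectangle a b c d := by
      intro hS
      obtain ⟨z, hz, hzS, hzh⟩ : ∃ z, (z = ne k.top ∨ z = nw k.top) ∧
          s(k.top, z) ∈ edgeSet (rectangle a b c d) ∧
          h ∈ Set.Ioc (lowLevel P s(k.top, z)) (highLevel P s(k.top, z)) := by
        have hb := hP.level_mem_Ioc hhk k.top_mem
        rcases le_or_gt h (P (k.top.1, k.top.2 + 1)) with h₁ | h₁
        · refine ⟨_, .inr rfl, ⟨_, hS, by simp [eNW]⟩, ?_⟩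
          have h₂ := hP.lowLevel_eNW k.top
          have h₃ := hP.highLevel_eNW k.top
          rw [eNW] at h₂ h₃
          rw [h₂, h₃]; exact ⟨hb.1, h₁⟩
        · refine ⟨_, .inl rfl, ⟨_, hS, by simp [eNE]⟩, ?_⟩
          have h₂ := hP.lowLevel_eNE k.top
          have h₃ := hP.highLevel_eNE k.top
          rw [eNE] at h₂ h₃
          rw [h₂, h₃]; exact ⟨h₁, hb.2⟩
      have hpart : k.IsPartOf (k.append z hz) := (List.prefix_append k.sites [z]).isInfix
      have hlen : (k.append z hz).sites.length = k.sites.length + 1 := by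
        simp [BrokenTrace.append]
      have := hmax (j := k.append z hz) ⟨fun e he => ?_, hlk.trans hpart, fun e he => ?_⟩ (by
        simp only [hlen]; omega)
      · simp only [hlen] at this; omega
      · rcases BrokenTrace.mem_edges_append he with he | rfl
        exacts [hk e he, hzS]
      · rcases BrokenTrace.mem_edges_append he with he | rfl
        exacts [hhk e he, hzh]
    refine mem_outerBoundary_of_adjacent rectangle_subset_evenLattice htop ?_
    rcases BrokenTrace.exists_prev k.top_mem k.bottom_height_lt_top with n | n
    · have := hk _ (BrokenTrace.eSW_mem_edges.2 ⟨k.top_mem, n⟩)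
      rw [eSW_eq, eNE_mem_edgeSet] at this
      simp only [ne, sw, sub_add_cancel] at this ⊢; tauto
    · have := hk _ (BrokenTrace.eSE_mem_edges.2 ⟨k.top_mem, n⟩)
      rw [eSE_eq, eNW_mem_edgeSet] at this
      simp only [nw, se, sub_add_cancel, add_sub_cancel_right] at this ⊢; tauto

/-! ### Weights add up -/

/-- The levels of a trace are partitioned by the levels of the crossing traces that contain it. -/
theorem IsPotential.weightsAdd (hab : a ≤ b) (hcd : c ≤ d)
    (hP : IsPotential (rectangle a b c d) η P) : WeightsAdd (rectangle a b c d) η := by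
  intro k hk
  have hfin : Finite {k' // k' ∈ BrokenTrace.crossing (rectangle a b c d) ∧ k.IsPartOf k'} :=
    (BrokenTrace.finite_crossing.subset fun _ h => h.1).to_subtype
  have := Fintype.ofFinite {k' // k' ∈ BrokenTrace.crossing (rectangle a b c d) ∧ k.IsPartOf k'}
  have hunion : levels P k =
      ⋃ k' : {k' // k' ∈ BrokenTrace.crossing (rectangle a b c d) ∧ k.IsPartOf k'},
        levels P k'.1 := by
    apply subset_antisymm
    · intro r hr
      obtain ⟨k', hk', hkk', hr'⟩ := hP.exists_crossing hk hr
      exact Set.mem_iUnion.2 ⟨⟨k', hk', hkk'⟩, hr'⟩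
    · exact Set.iUnion_subset fun k' => levels_antitone k'.2.2
  have hdisj : Pairwise (Function.onFun Disjoint
      fun k' : {k' // k' ∈ BrokenTrace.crossing (rectangle a b c d) ∧ k.IsPartOf k'} =>
        levels P k'.1) := fun k₁ k₂ hne => Set.disjoint_left.2 fun r h₁ h₂ =>
    hne (Subtype.ext (hP.crossing_unique hab hcd k₁.2.1 k₂.2.1 h₁ h₂))
  rw [traceWeight_eq_volume hP hk, hunion, MeasureTheory.measureReal_iUnion_fintype hdisj
    (fun k' => measurableSet_levels P k'.1) (fun k' => levels_finite_measure P k'.1)]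
  simp only [fun k' : {k' // k' ∈ BrokenTrace.crossing (rectangle a b c d) ∧ k.IsPartOf k'} =>
    traceWeight_eq_volume hP k'.2.1.1]
  exact hasSum_fintype _

/-! ### Recovering the flow from the weights -/

section decomposition

variable {S : Set Site} {a b c d : ℤ} {η : Edge → ℝ} {P : Site → ℝ} {n : ℕ}
  {l : Fin n → BrokenTrace} {w : Fin n → ℝ}

/-- The trace that consists of a single edge. -/
def BrokenTrace.single (y z : Site) (hy : y ∈ evenLattice) (h : z = ne y ∨ z = nw y) :
    BrokenTrace where
  sites := [y, z]
  two_le_length := le_rfl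
  mem_evenLattice := by
    rw [mem_evenLattice_iff] at hy
    simp only [List.mem_cons, List.not_mem_nil, or_false, forall_eq_or_imp, forall_eq,
      mem_evenLattice_iff]
    rcases h with rfl | rfl <;> simp only [ne, nw] <;> omega
  isChain := by simpa using h

/-- The trace that passes through `y` and has a left corner there. -/
def BrokenTrace.corner (y : Site) (hy : y ∈ evenLattice) : BrokenTrace where
  sites := [se y, y, ne y]
  two_le_length := by simp
  mem_evenLattice := by
    rw [mem_evenLattice_iff] at hy
    simp only [List.mem_cons, List.not_mem_nil, or_false, forall_eq_or_imp, forall_eq,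
      mem_evenLattice_iff, se, ne]
    omega
  isChain := by simp [nw, se]

theorem IsPotential.traceWeight_single (hP : IsPotential (rectangle a b c d) η P) {y z : Site}
    (hy : y ∈ evenLattice) (h : z = ne y ∨ z = nw y) (he : s(y, z) ∈ edgeSet (rectangle a b c d))
    (hpos : 0 ≤ η s(y, z)) :
    traceWeight (rectangle a b c d) η (.single y z hy h) = η s(y, z) := by
  have hedges : (BrokenTrace.single y z hy h).edges = [s(y, z)] := rfl
  rw [traceWeight_eq_volume hP (by intro e; rw [hedges, List.mem_singleton]; rintro rfl; exact he)]
  have : levels P (.single y z hy h) = Set.Ioc (lowLevel P s(y, z)) (highLevel P s(y, z)) := by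
    ext r; simp [levels, hedges]
  rw [hP.flow_eq he] at hpos ⊢
  rw [this, Real.volume_real_Ioc, max_eq_left hpos]

theorem IsPotential.traceWeight_corner (hP : IsPotential (rectangle a b c d) η P) {y : Site}
    (hy : y ∈ rectangle a b c d) (hpos : 0 ≤ birthAt η y) :
    traceWeight (rectangle a b c d) η (.corner y hy.1) = birthAt η y := by
  have hedges : (BrokenTrace.corner y hy.1).edges = [eSE y, eNE y] := by
    simp [BrokenTrace.edges, BrokenTrace.corner, eSE, eNE, Sym2.eq_swap]
  rw [traceWeight_eq_volume hP]
  · have : levels P (.corner y hy.1) =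
        Set.Ioc (P (y.1, y.2 - 1) ⊔ P (y.1, y.2 + 1)) (P (y.1 + 1, y.2)) := by
      ext r
      simp only [levels, hedges, List.forall_mem_cons, List.not_mem_nil, false_imp_iff,
        implies_true, and_true, hP.lowLevel_eSE, hP.highLevel_eSE, hP.lowLevel_eNE,
        hP.highLevel_eNE, Set.mem_ofPred_eq, Set.mem_Ioc, sup_lt_iff]
      tauto
    have hb : birthAt η y = P (y.1 + 1, y.2) - (P (y.1, y.2 - 1) ⊔ P (y.1, y.2 + 1)) := by
      obtain ⟨h1, h2, h3, h4⟩ := hP.flow_site hy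
      rw [birthAt, h1, h3, min_sub_sub_left, max_comm]
    rw [hb] at hpos ⊢
    rw [this, Real.volume_real_Ioc, max_eq_left hpos]
  · intro e he
    rw [hedges] at he
    simp only [List.mem_cons, List.not_mem_nil, or_false] at he
    exact ⟨y, hy, by tauto⟩

open Classical in
/-- The additivity of the weights, when the crossing traces of positive weight are listed. -/
theorem traceWeight_eq_sum (hadd : WeightsAdd S η) (hl : ∀ j, l j ∈ BrokenTrace.crossing S)
    (hinj : Function.Injective l) (hw : HasCrossingWeights S η l w) {k : BrokenTrace}
    (hk : k.IsIn S) : traceWeight S η k = ∑ j, if k.IsPartOf (l j) then w j else 0 := by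
  have h : HasSum ({k' | k' ∈ BrokenTrace.crossing S ∧ k.IsPartOf k'}.indicator (traceWeight S η))
      (traceWeight S η k) := hasSum_subtype_iff_indicator.1 (hadd k hk)
  rw [← hinj.hasSum_iff] at h
  · rw [h.unique (hasSum_fintype _)]
    refine Finset.sum_congr rfl fun j _ => ?_
    simp [Set.indicator_apply, hl j, (hw _ (hl j)).1 j rfl]
  · intro k' hk'
    rw [Set.indicator_apply_eq_zero]
    intro hk''
    exact (hw k' hk''.1).2 fun j hj => hk' ⟨j, hj.symm⟩

/-- A flow field determines the entering flow and the births. -/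
theorem isFlowFieldOf_iff (hη : IsFlowField S η) (ζ : BoundaryFlow) (ξ : Site → ℝ) :
    IsFlowFieldOf S ζ ξ η ↔
      ζ = ((southwestSide S).indicator fun y => η (eSW y),
        (northwestSide S).indicator fun y => η (eNW y)) ∧ ξ = S.indicator (birthAt η) := by
  classical
  constructor
  · intro h
    refine ⟨Prod.ext ?_ ?_, ?_⟩ <;> funext y <;> simp only [Set.indicator_apply]
    · split_ifs with hy
      exacts [(h.entering_plus y hy).symm, h.boundary_plus_eq_zero y hy]
    · split_ifs with hy
      exacts [(h.entering_minus y hy).symm, h.boundary_minus_eq_zero y hy]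
    · split_ifs with hy
      · have h1 := h.leaving_plus y hy
        have h2 := h.leaving_minus y hy
        rcases le_total (η (eSW y)) (η (eNW y)) with h3 | h3
        · rw [max_eq_right (by linarith)] at h1
          rw [max_eq_left (by linarith)] at h2
          rw [birthAt, min_eq_left] <;> linarith
        · rw [max_eq_left (by linarith)] at h1
          rw [max_eq_right (by linarith)] at h2
          rw [birthAt, min_eq_right] <;> linarith
      · exact h.birth_eq_zero y hy
  · rintro ⟨rfl, rfl⟩
    have hpos : ∀ y ∈ S, 0 ≤ η (eNE y) ∧ 0 ≤ η (eNW y) ∧ 0 ≤ η (eSE y) ∧ 0 ≤ η (eSW y) := by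
      intro y hy
      refine ⟨hη.nonneg _ ⟨y, hy, ?_⟩, hη.nonneg _ ⟨y, hy, ?_⟩, hη.nonneg _ ⟨y, hy, ?_⟩,
        hη.nonneg _ ⟨y, hy, ?_⟩⟩ <;> simp
    refine ⟨fun y => ⟨?_, ?_⟩, fun y => ?_, fun y hy => ?_, fun y hy => ?_, fun y hy => ?_,
      hη.eq_zero, fun y hy => ?_, fun y hy => ?_, fun y hy => ?_, fun y hy => ?_⟩
    · exact Set.indicator_nonneg (fun y hy => (hpos y hy.1).2.2.2) y
    · exact Set.indicator_nonneg (fun y hy => (hpos y hy.1).2.1) y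
    · exact Set.indicator_nonneg (fun y hy => le_min (hpos y hy).1 (hpos y hy).2.2.1) y
    · exact Set.indicator_of_notMem hy fun y => η (eSW y)
    · exact Set.indicator_of_notMem hy fun y => η (eNW y)
    · exact Set.indicator_of_notMem hy _
    · exact (Set.indicator_of_mem hy (fun y => η (eSW y))).symm
    · exact (Set.indicator_of_mem hy (fun y => η (eNW y))).symm
    · rw [hη.conservation y hy, Set.indicator_of_mem hy, birthAt, ← sub_self (η (eSE y)),
        max_sub_sub_right]
      linarith [min_add_max (η (eNE y)) (η (eSE y))]
    · have : η (eNW y) - η (eSW y) = η (eSE y) - η (eNE y) := by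
        linarith [hη.conservation y hy]
      rw [this, Set.indicator_of_mem hy, birthAt, ← sub_self (η (eNE y)), max_sub_sub_right]
      linarith [min_add_max (η (eNE y)) (η (eSE y)), max_comm (η (eNE y)) (η (eSE y))]

/-- The flow, the entering flow and the births are superpositions of those of the crossing traces,
because they are the weights of traces with one edge or with one left corner. -/
theorem decomposes (hη : IsFlowField (rectangle a b c d) η)
    (hP : IsPotential (rectangle a b c d) η P) (hadd : WeightsAdd (rectangle a b c d) η)
    (hl : ∀ j, l j ∈ BrokenTrace.crossing (rectangle a b c d)) (hinj : Function.Injective l)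
    (hw : HasCrossingWeights (rectangle a b c d) η l w) :
    Decomposes (rectangle a b c d) η l w := by
  classical
  have hsub : ∀ y, y ∈ rectangle a b c d → (y.1 + y.2) % 2 = 0 := fun y hy => (mem_rectangle.1 hy).1
  have hpair : ∀ (y z : Site), y ∈ evenLattice → z = ne y ∨ z = nw y →
      s(y, z) ∈ edgeSet (rectangle a b c d) →
      η s(y, z) = ∑ j, if y ∈ (l j).sites ∧ z ∈ (l j).sites then w j else 0 := by
    intro y z hy h he
    rw [← hP.traceWeight_single hy h he (hη.nonneg _ he),
      traceWeight_eq_sum hadd hl hinj hw]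
    · simp [BrokenTrace.isPartOf_iff_subset, BrokenTrace.single]
    · intro e he'
      have : e = s(y, z) := by simpa [BrokenTrace.edges, BrokenTrace.single] using he'
      exact this ▸ he
  have hflow : ∀ e ∈ edgeSet (rectangle a b c d),
      η e = ∑ j, if e ∈ (l j).edges then w j else 0 := by
    intro e he
    obtain ⟨y, rfl | rfl⟩ := exists_eq_of_mem_edgeSet he
    · simp only [BrokenTrace.eNE_mem_edges]
      refine hpair y _ ?_ (.inl rfl) he
      rw [mem_evenLattice_iff]
      rcases eNE_mem_edgeSet.1 he with h | h <;> have := hsub _ h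
      · exact this
      · simp only [ne] at this; omega
    · simp only [BrokenTrace.eNW_mem_edges]
      refine hpair y _ ?_ (.inr rfl) he
      rw [mem_evenLattice_iff]
      rcases eNW_mem_edgeSet.1 he with h | h <;> have := hsub _ h
      · exact this
      · simp only [nw] at this; omega
  refine ⟨?_, fun ζ ξ => ?_⟩
  · funext e
    simp only [Finset.sum_apply, Pi.smul_apply, smul_eq_mul, BrokenTrace.flow, Set.indicator_apply,
      Set.mem_ofPred_eq, Pi.one_apply, mul_ite, mul_one, mul_zero]
    by_cases he : e ∈ edgeSet (rectangle a b c d)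
    · exact hflow e he
    · rw [hη.eq_zero e he, Finset.sum_eq_zero]
      intro j _
      rw [if_neg]
      exact fun h => he ((hl j).1 e h)
  · have hbirth : (rectangle a b c d).indicator (birthAt η) = ∑ j, w j • (l j).birth := by
      funext y
      simp only [Finset.sum_apply, Pi.smul_apply, smul_eq_mul, BrokenTrace.birth,
        Set.indicator_apply, Pi.one_apply, mul_ite, mul_one, mul_zero, BrokenTrace.leftCorners,
        Set.mem_ofPred_eq]
      split_ifs with hy
      · have hpos : 0 ≤ birthAt η y :=
          le_min (hη.nonneg _ ⟨y, hy, by simp⟩) (hη.nonneg _ ⟨y, hy, by simp⟩)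
        rw [← hP.traceWeight_corner hy hpos, traceWeight_eq_sum hadd hl hinj hw]
        · refine Finset.sum_congr rfl fun j _ => if_congr ?_ rfl rfl
          simp only [BrokenTrace.isPartOf_iff_subset, BrokenTrace.corner, List.cons_subset,
            List.nil_subset, and_true]
          tauto
        · intro e he
          have : e = eSE y ∨ e = eNE y := by
            simpa [BrokenTrace.edges, BrokenTrace.corner, eSE, eNE, Sym2.eq_swap] using he
          exact ⟨y, hy, by tauto⟩
      · rw [Finset.sum_eq_zero]
        intro j _
        rw [if_neg]
        rintro ⟨h₁, h₂, h₃⟩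
        refine hy (BrokenTrace.isIn_site (hl j).1 h₁ ?_ ?_)
        · have := BrokenTrace.bottom_le h₃
          simp only [se] at this; omega
        · have := BrokenTrace.le_top h₂
          simp only [ne] at this; omega
    have hboundary : ((southwestSide (rectangle a b c d)).indicator fun y => η (eSW y),
        (northwestSide (rectangle a b c d)).indicator fun y => η (eNW y)) =
          ∑ j, w j • (l j).boundaryFlow (rectangle a b c d) := by
      refine Prod.ext ?_ ?_
      · rw [Prod.fst_sum]
        funext y
        simp only [Finset.sum_apply, Prod.smul_fst, Pi.smul_apply, smul_eq_mul,
          BrokenTrace.boundaryFlow, Set.indicator_apply, Pi.one_apply, mul_ite, mul_one, mul_zero,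
          Set.mem_ofPred_eq]
        split_ifs with hy
        · rw [hflow _ ⟨y, hy.1, by simp⟩]
          refine Finset.sum_congr rfl fun j _ => if_congr ?_ rfl rfl
          have := mem_outerBoundary_of_adjacent rectangle_subset_evenLattice hy.2
            (.inl (by simpa [ne, sw] using hy.1))
          rw [BrokenTrace.eSW_mem_edges]
          have := hy.1
          tauto
        · rw [Finset.sum_eq_zero]
          intro j _
          rw [if_neg]
          rintro ⟨-, h₁, -, h₂⟩
          exact hy ⟨h₁, h₂.2⟩
      · rw [Prod.snd_sum]
        funext y
        simp only [Finset.sum_apply, Prod.smul_snd, Pi.smul_apply, smul_eq_mul,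
          BrokenTrace.boundaryFlow, Set.indicator_apply, Pi.one_apply, mul_ite, mul_one, mul_zero,
          Set.mem_ofPred_eq]
        split_ifs with hy
        · rw [hflow _ ⟨y, hy.1, by simp⟩]
          refine Finset.sum_congr rfl fun j _ => if_congr ?_ rfl rfl
          have := mem_outerBoundary_of_adjacent rectangle_subset_evenLattice hy.2
            (.inr (.inr (.inl (by simpa [se, nw] using hy.1))))
          rw [BrokenTrace.eNW_mem_edges]
          have := hy.1
          tauto
        · rw [Finset.sum_eq_zero]
          intro j _
          rw [if_neg]
          rintro ⟨-, h₁, -, h₂⟩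
          exact hy ⟨h₁, h₂.2⟩
    rw [isFlowFieldOf_iff hη, hbirth, hboundary]

end decomposition

/-! ### The potential of a crossing trace -/

section chain

variable {a b c d : ℤ} {k l : BrokenTrace}

/-- The indicator function of the faces to the right of a trace. -/
noncomputable def rightIndicator (l : BrokenTrace) : Site → ℝ :=
  Set.indicator {f | ∃ y ∈ l.sites, IsRightOf y f} 1

theorem rightIndicator_eq_one {f y : Site} (hy : y ∈ l.sites) (h : IsRightOf y f) :
    rightIndicator l f = 1 :=
  Set.indicator_of_mem (s := {f | ∃ y ∈ l.sites, IsRightOf y f}) ⟨y, hy, h⟩ 1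

theorem rightIndicator_eq_zero {f y : Site} (hy : y ∈ l.sites) (h : IsRightOf f y) :
    rightIndicator l f = 0 := by
  refine Set.indicator_of_notMem ?_ _
  rintro ⟨z, hz, h'⟩
  exact BrokenTrace.not_isRightOf_self hz hy ⟨h'.1.trans h.1, h'.2.trans h.2⟩

theorem rightIndicator_nonneg (f : Site) : 0 ≤ rightIndicator l f :=
  Set.indicator_nonneg (fun _ _ => zero_le_one) f

theorem rightIndicator_le_one (f : Site) : rightIndicator l f ≤ 1 := by
  classical
  rw [rightIndicator, Set.indicator_apply]; split_ifs <;> simp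

theorem rightIndicator_mono {f g : Site} (h₁ : f.1 + f.2 ≤ g.1 + g.2) (h₂ : f.1 - f.2 ≤ g.1 - g.2) :
    rightIndicator l f ≤ rightIndicator l g := by
  by_cases h : ∃ y ∈ l.sites, IsRightOf y f
  · obtain ⟨y, hy, hyf⟩ := h
    rw [rightIndicator_eq_one hy hyf, rightIndicator_eq_one hy
      ⟨hyf.1.trans_le h₁, hyf.2.trans_le h₂⟩]
  · rw [rightIndicator, Set.indicator_of_notMem (by exact h)]
    exact rightIndicator_nonneg g

/-- A face of the rectangle lies to the left or to the right of a crossing trace. -/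
theorem BrokenTrace.left_or_right (hl : l ∈ crossing (rectangle a b c d)) {f : Site}
    (hf : (f.1 + f.2) % 2 = 1) (h₁ : 2 * a - 1 ≤ f.1 + f.2) (h₂ : f.1 + f.2 ≤ 2 * b + 1)
    (h₃ : 2 * c - 1 ≤ f.1 - f.2) (h₄ : f.1 - f.2 ≤ 2 * d + 1) :
    (∃ y ∈ l.sites, IsRightOf y f) ∨ ∃ y ∈ l.sites, IsRightOf f y := by
  have key : ∀ y ∈ l.sites, (IsRightOf y f ∨ IsRightOf f y) →
      (∃ y ∈ l.sites, IsRightOf y f) ∨ ∃ y ∈ l.sites, IsRightOf f y := by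
    rintro y hy (h | h)
    exacts [.inl ⟨y, hy, h⟩, .inr ⟨y, hy, h⟩]
  have hb := (crossing_bottom hl).2
  have ht := (crossing_top hl).2
  rcases lt_or_ge f.2 l.bottom.2 with h | h
  · exact key _ l.bottom_mem (by unfold IsRightOf; omega)
  rcases lt_or_ge l.top.2 f.2 with h' | h'
  · exact key _ l.top_mem (by unfold IsRightOf; omega)
  obtain ⟨y, hy, hy'⟩ := exists_site h h'
  have := mem_evenLattice_iff.1 (l.mem_evenLattice y hy)
  exact key y hy (by unfold IsRightOf; omega)

/-- Across the edges of the rectangle, the right indicator of a crossing trace jumps exactly at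
the edges of the trace. -/
theorem isPotential_rightIndicator (hl : l ∈ BrokenTrace.crossing (rectangle a b c d)) :
    IsPotential (rectangle a b c d) l.flow (rightIndicator l) := by
  have hone : ∀ e, e ∈ l.edges → l.flow e = 1 := fun e he =>
    Set.indicator_of_mem (s := {e | e ∈ l.edges}) he 1
  have hzero : ∀ e, e ∉ l.edges → l.flow e = 0 := fun e he =>
    Set.indicator_of_notMem (s := {e | e ∈ l.edges}) he 1
  -- If the two faces of an edge are on different sides, there are sites `z'` and `z` of the trace
  -- such that the edge is in the closed right cone of `z'` and `z` in that of the edge. The trace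
  -- then goes straight from `z'` to `z`, through the edge.
  refine ⟨fun _ _ => rightIndicator_mono, fun y he => ?_, fun y he => ?_⟩
  · by_cases hy : eNE y ∈ l.edges
    · rw [hone _ hy]
      rw [BrokenTrace.eNE_mem_edges] at hy
      rw [rightIndicator_eq_one hy.1 ⟨by dsimp only; omega, by dsimp only; omega⟩,
        rightIndicator_eq_zero hy.2 ⟨by simp only [ne]; omega, by simp only [ne]; omega⟩, sub_zero]
    · rw [hzero _ hy, eq_comm, sub_eq_zero]
      rw [eNE_mem_edgeSet] at he
      simp only [mem_rectangle, ne] at he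
      have hL := BrokenTrace.left_or_right hl (f := (y.1, y.2 + 1)) (by dsimp only; omega)
        (by dsimp only; omega) (by dsimp only; omega) (by dsimp only; omega) (by dsimp only; omega)
      have hR := BrokenTrace.left_or_right hl (f := (y.1 + 1, y.2)) (by dsimp only; omega)
        (by dsimp only; omega) (by dsimp only; omega) (by dsimp only; omega) (by dsimp only; omega)
      rcases hL with ⟨z, hz, hz'⟩ | ⟨z, hz, hz'⟩
      · rw [rightIndicator_eq_one hz hz', rightIndicator_eq_one hz
          ⟨hz'.1.trans_le (by dsimp only; omega), hz'.2.trans_le (by dsimp only; omega)⟩]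
      rcases hR with ⟨z', hw, hw'⟩ | ⟨z', hw, hw'⟩
      · exfalso
        apply hy
        unfold IsRightOf at hz' hw'
        dsimp only at hz' hw'
        have p₁ := mem_evenLattice_iff.1 (l.mem_evenLattice z hz)
        have p₂ := mem_evenLattice_iff.1 (l.mem_evenLattice z' hw)
        have hlt : z'.2 ≤ z.2 := by
          by_contra! hlt
          have := BrokenTrace.slope hz hw hlt.le
          omega
        have hs := BrokenTrace.slope hw hz hlt
        have hb := BrokenTrace.bottom_le hw
        have ht := BrokenTrace.le_top hz
        obtain ⟨u, hu, hu'⟩ := l.exists_site (x := y.2) (by omega) (by omega)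
        obtain ⟨v, hv, hv'⟩ := l.exists_site (x := y.2 + 1) (by omega) (by omega)
        have := BrokenTrace.slope hw hu (by omega)
        have := BrokenTrace.slope hu hv (by omega)
        have := BrokenTrace.slope hv hz (by omega)
        rw [BrokenTrace.eNE_mem_edges]
        obtain rfl : u = y := by ext <;> omega
        obtain rfl : v = ne u := by ext <;> simp only [ne] <;> omega
        exact ⟨hu, hv⟩
      · rw [rightIndicator_eq_zero hw hw', rightIndicator_eq_zero hz hz']
  · by_cases hy : eNW y ∈ l.edges
    · rw [hone _ hy]
      rw [BrokenTrace.eNW_mem_edges] at hy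
      rw [rightIndicator_eq_one hy.2 ⟨by simp only [nw]; omega, by simp only [nw]; omega⟩,
        rightIndicator_eq_zero hy.1 ⟨by dsimp only; omega, by dsimp only; omega⟩, sub_zero]
    · rw [hzero _ hy, eq_comm, sub_eq_zero]
      rw [eNW_mem_edgeSet] at he
      simp only [mem_rectangle, nw] at he
      have hL := BrokenTrace.left_or_right hl (f := (y.1 - 1, y.2)) (by dsimp only; omega)
        (by dsimp only; omega) (by dsimp only; omega) (by dsimp only; omega) (by dsimp only; omega)
      have hR := BrokenTrace.left_or_right hl (f := (y.1, y.2 + 1)) (by dsimp only; omega)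
        (by dsimp only; omega) (by dsimp only; omega) (by dsimp only; omega) (by dsimp only; omega)
      rcases hL with ⟨z, hz, hz'⟩ | ⟨z, hz, hz'⟩
      · rw [rightIndicator_eq_one hz hz', rightIndicator_eq_one hz
          ⟨hz'.1.trans_le (by dsimp only; omega), hz'.2.trans_le (by dsimp only; omega)⟩]
      rcases hR with ⟨z', hw, hw'⟩ | ⟨z', hw, hw'⟩
      · exfalso
        apply hy
        unfold IsRightOf at hz' hw'
        dsimp only at hz' hw'
        have p₁ := mem_evenLattice_iff.1 (l.mem_evenLattice z hz)
        have p₂ := mem_evenLattice_iff.1 (l.mem_evenLattice z' hw)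
        have hlt : z.2 ≤ z'.2 := by
          by_contra! hlt
          have := BrokenTrace.slope hw hz hlt.le
          omega
        have hs := BrokenTrace.slope hz hw hlt
        have hb := BrokenTrace.bottom_le hz
        have ht := BrokenTrace.le_top hw
        obtain ⟨u, hu, hu'⟩ := l.exists_site (x := y.2) (by omega) (by omega)
        obtain ⟨v, hv, hv'⟩ := l.exists_site (x := y.2 + 1) (by omega) (by omega)
        have := BrokenTrace.slope hz hu (by omega)
        have := BrokenTrace.slope hu hv (by omega)
        have := BrokenTrace.slope hv hw (by omega)
        rw [BrokenTrace.eNW_mem_edges]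
        obtain rfl : u = y := by ext <;> omega
        obtain rfl : v = nw u := by ext <;> simp only [nw] <;> omega
        exact ⟨hu, hv⟩
      · rw [rightIndicator_eq_zero hw hw', rightIndicator_eq_zero hz hz']

theorem lowLevel_highLevel_rightIndicator
    (hl : l ∈ BrokenTrace.crossing (rectangle a b c d)) {e : Edge} (he : e ∈ l.edges) :
    lowLevel (rightIndicator l) e = 0 ∧ highLevel (rightIndicator l) e = 1 := by
  have hQ := isPotential_rightIndicator hl
  have h1 : l.flow e = 1 := Set.indicator_of_mem (s := {e | e ∈ l.edges}) he 1
  have h2 := hQ.flow_eq (hl.1 e he)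
  rw [h1] at h2
  have h3 : 0 ≤ lowLevel (rightIndicator l) e := by
    obtain ⟨y, rfl | rfl⟩ := exists_eq_of_mem_edgeSet (hl.1 e he)
    · rw [hQ.lowLevel_eNE]; exact rightIndicator_nonneg _
    · rw [hQ.lowLevel_eNW]; exact rightIndicator_nonneg _
  have h4 : highLevel (rightIndicator l) e ≤ 1 := by
    obtain ⟨y, rfl | rfl⟩ := exists_eq_of_mem_edgeSet (hl.1 e he)
    · rw [hQ.highLevel_eNE]; exact rightIndicator_le_one _
    · rw [hQ.highLevel_eNW]; exact rightIndicator_le_one _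
  constructor <;> linarith

/-- Crossing traces are equal if their right indicators agree on the faces of their edges. -/
theorem eq_of_levels_rightIndicator (hab : a ≤ b) (hcd : c ≤ d)
    (hk : k ∈ BrokenTrace.crossing (rectangle a b c d))
    (hl : l ∈ BrokenTrace.crossing (rectangle a b c d))
    (h : ∀ e ∈ edgeSet (rectangle a b c d),
      lowLevel (rightIndicator k) e = lowLevel (rightIndicator l) e ∧
      highLevel (rightIndicator k) e = highLevel (rightIndicator l) e) : k = l := by
  refine (isPotential_rightIndicator hl).crossing_unique (h := 1) hab hcd hk hl
    (fun e he => ?_) (fun e he => ?_)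
  · rw [← (h e (hk.1 e he)).1, ← (h e (hk.1 e he)).2]
    simp [lowLevel_highLevel_rightIndicator hk he]
  · simp [lowLevel_highLevel_rightIndicator hl he]

/-- The right indicators of ordered crossing traces are ordered. -/
theorem rightIndicator_le_of_le (hab : a ≤ b) (hcd : c ≤ d)
    (hk : k ∈ BrokenTrace.crossing (rectangle a b c d))
    (hl : l ∈ BrokenTrace.crossing (rectangle a b c d)) (hkl : k.Le l) {e : Edge}
    (he : e ∈ edgeSet (rectangle a b c d)) :
    lowLevel (rightIndicator l) e ≤ lowLevel (rightIndicator k) e ∧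
      highLevel (rightIndicator l) e ≤ highLevel (rightIndicator k) e := by
  have key : ∀ f : Site, (f.1 + f.2) % 2 = 1 → 2 * a - 1 ≤ f.1 + f.2 → f.1 + f.2 ≤ 2 * b + 1 →
      2 * c - 1 ≤ f.1 - f.2 → f.1 - f.2 ≤ 2 * d + 1 →
      rightIndicator l f ≤ rightIndicator k f := by
    intro f hf h₁ h₂ h₃ h₄
    rcases BrokenTrace.left_or_right hk hf h₁ h₂ h₃ h₄ with ⟨y, hy, h⟩ | ⟨y, hy, h⟩
    · rw [rightIndicator_eq_one hy h]; exact rightIndicator_le_one f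
    rcases BrokenTrace.left_or_right hl hf h₁ h₂ h₃ h₄ with ⟨z, hz, h'⟩ | ⟨z, hz, h'⟩
    · exact absurd ⟨h'.1.trans h.1, h'.2.trans h.2⟩ (hkl.not_isRightOf hab hcd hk hl hz hy)
    · rw [rightIndicator_eq_zero hz h']; exact rightIndicator_nonneg f
  have hQk := isPotential_rightIndicator hk
  have hQl := isPotential_rightIndicator hl
  obtain ⟨y, rfl | rfl⟩ := exists_eq_of_mem_edgeSet he
  · rw [hQk.lowLevel_eNE, hQl.lowLevel_eNE, hQk.highLevel_eNE, hQl.highLevel_eNE]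
    rw [eNE_mem_edgeSet] at he
    simp only [mem_rectangle, ne] at he
    constructor <;> apply key <;> dsimp only <;> omega
  · rw [hQk.lowLevel_eNW, hQl.lowLevel_eNW, hQk.highLevel_eNW, hQl.highLevel_eNW]
    rw [eNW_mem_edgeSet] at he
    simp only [mem_rectangle, nw] at he
    constructor <;> apply key <;> dsimp only <;> omega

end chain

/-! ### Superpositions of ordered crossing traces -/

section superposition

variable {a b c d : ℤ} {n : ℕ} {l : Fin n → BrokenTrace} {w : Fin n → ℝ}

/-- The levels of the right indicators decrease along a chain of crossing traces. -/
theorem rightIndicator_antitone (hab : a ≤ b) (hcd : c ≤ d)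
    (hl : ∀ j, l j ∈ BrokenTrace.crossing (rectangle a b c d))
    (hchain : ∀ i j : Fin n, (i : ℕ) + 1 = j → (l i).Lt (l j)) {e : Edge}
    (he : e ∈ edgeSet (rectangle a b c d)) {i j : Fin n} (hij : i ≤ j) :
    lowLevel (rightIndicator (l j)) e ≤ lowLevel (rightIndicator (l i)) e ∧
      highLevel (rightIndicator (l j)) e ≤ highLevel (rightIndicator (l i)) e := by
  obtain ⟨j, hj⟩ := j
  replace hij : (i : ℕ) ≤ j := hij
  induction j, hij using Nat.le_induction with
  | base => exact ⟨le_rfl, le_rfl⟩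
  | succ j hij ih =>
    have h₁ := ih (by omega)
    have h₂ := rightIndicator_le_of_le hab hcd (hl ⟨j, by omega⟩) (hl ⟨j + 1, hj⟩)
      (hchain ⟨j, by omega⟩ ⟨j + 1, hj⟩ rfl).1 he
    exact ⟨h₂.1.trans h₁.1, h₂.2.trans h₁.2⟩

/-- The members of a chain of crossing traces are distinct. -/
theorem injective_of_chain (hab : a ≤ b) (hcd : c ≤ d)
    (hl : ∀ j, l j ∈ BrokenTrace.crossing (rectangle a b c d))
    (hchain : ∀ i j : Fin n, (i : ℕ) + 1 = j → (l i).Lt (l j)) : Function.Injective l := by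
  have key : ∀ i j : Fin n, i < j → l i ≠ l j := by
    intro i j hij h
    have hij' : (i : ℕ) < j := hij
    let i' : Fin n := ⟨i + 1, by omega⟩
    apply (hchain i i' rfl).2
    apply eq_of_levels_rightIndicator hab hcd (hl i) (hl i')
    intro e he
    have h₁ := rightIndicator_antitone hab hcd hl hchain he (i := i) (j := i')
      (show (i : ℕ) ≤ i + 1 by omega)
    have h₂ := rightIndicator_antitone hab hcd hl hchain he (i := i') (j := j)
      (show (i : ℕ) + 1 ≤ j by omega)
    rw [← h] at h₂
    exact ⟨le_antisymm h₂.1 h₁.1, le_antisymm h₂.2 h₁.2⟩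
  intro i j h
  rcases lt_trichotomy i j with hij | hij | hij
  exacts [absurd h (key i j hij), hij, absurd h.symm (key j i hij)]

/-- The potential of a superposition of crossing traces. -/
theorem isPotential_sum (hl : ∀ j, l j ∈ BrokenTrace.crossing (rectangle a b c d))
    (hw : ∀ j, 0 < w j) :
    IsPotential (rectangle a b c d) (∑ j, w j • (l j).flow)
      (fun f => ∑ j, w j * rightIndicator (l j) f) := by
  refine ⟨fun f g h₁ h₂ => ?_, fun y he => ?_, fun y he => ?_⟩
  · exact Finset.sum_le_sum fun j _ => mul_le_mul_of_nonneg_left (rightIndicator_mono h₁ h₂)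
      (hw j).le
  · simp only [Finset.sum_apply, Pi.smul_apply, smul_eq_mul, ← Finset.sum_sub_distrib, ← mul_sub]
    exact Finset.sum_congr rfl fun j _ => by
      rw [(isPotential_rightIndicator (hl j)).flow_ne y he]
  · simp only [Finset.sum_apply, Pi.smul_apply, smul_eq_mul, ← Finset.sum_sub_distrib, ← mul_sub]
    exact Finset.sum_congr rfl fun j _ => by
      rw [(isPotential_rightIndicator (hl j)).flow_nw y he]

theorem isFlowField_sum (hl : ∀ j, l j ∈ BrokenTrace.crossing (rectangle a b c d))
    (hw : ∀ j, 0 < w j) : IsFlowField (rectangle a b c d) (∑ j, w j • (l j).flow) := by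
  refine (isPotential_sum hl hw).isFlowField fun e he => ?_
  rw [Finset.sum_apply]
  refine Finset.sum_eq_zero fun j _ => ?_
  have : (l j).flow e = 0 :=
    Set.indicator_of_notMem (s := {e | e ∈ (l j).edges}) (fun h => he ((hl j).1 e h)) 1
  simp [this]

/-- The intervals between consecutive partial sums of the weights cover `(0, ∑ i, w i]`. -/
theorem exists_partialSum_lt_le {h : ℝ} (h₀ : 0 < h) (h₁ : h ≤ ∑ i, w i) :
    ∃ j : Fin n, ∑ i, (if i < j then w i else 0) < h ∧ h ≤ ∑ i, (if i ≤ j then w i else 0) := by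
  classical
  have hex : ∃ m : ℕ, h ≤ ∑ i : Fin n, if (i : ℕ) < m then w i else 0 :=
    ⟨n, by simpa using h₁⟩
  obtain ⟨m, hm, hmin⟩ := Nat.findX hex
  have hmn : m ≤ n := by
    by_contra! hlt
    exact hmin n hlt (by simpa using h₁)
  cases m with
  | zero => simp at hm; linarith
  | succ m =>
    refine ⟨⟨m, hmn⟩, not_le.1 (hmin m (by omega)), ?_⟩
    simpa only [Fin.le_def, Nat.lt_succ_iff] using hm

/-- In the superposition of a chain of crossing traces `l j` with weights `w j`, the levels of `l j`
are those between the sums of the weights up to `j`, exclusive and inclusive. -/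
theorem hasCrossingWeights_sum (hab : a ≤ b) (hcd : c ≤ d)
    (hl : ∀ j, l j ∈ BrokenTrace.crossing (rectangle a b c d))
    (hchain : ∀ i j : Fin n, (i : ℕ) + 1 = j → (l i).Lt (l j)) (hw : ∀ j, 0 < w j) :
    HasCrossingWeights (rectangle a b c d) (∑ j, w j • (l j).flow) l w := by
  have hinj := injective_of_chain hab hcd hl hchain
  have hP := isPotential_sum hl hw
  set P : Site → ℝ := fun f => ∑ j, w j * rightIndicator (l j) f with hPdef
  have hsum : ∀ e ∈ edgeSet (rectangle a b c d),
      lowLevel P e = ∑ j, w j * lowLevel (rightIndicator (l j)) e ∧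
      highLevel P e = ∑ j, w j * highLevel (rightIndicator (l j)) e := by
    intro e he
    obtain ⟨y, rfl | rfl⟩ := exists_eq_of_mem_edgeSet he
    · rw [hP.lowLevel_eNE, hP.highLevel_eNE]
      simp only [fun j => (isPotential_rightIndicator (hl j)).lowLevel_eNE,
        fun j => (isPotential_rightIndicator (hl j)).highLevel_eNE]
      exact ⟨rfl, rfl⟩
    · rw [hP.lowLevel_eNW, hP.highLevel_eNW]
      simp only [fun j => (isPotential_rightIndicator (hl j)).lowLevel_eNW,
        fun j => (isPotential_rightIndicator (hl j)).highLevel_eNW]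
      exact ⟨rfl, rfl⟩
  have hlow : ∀ f, 0 ≤ P f := fun f =>
    Finset.sum_nonneg fun j _ => mul_nonneg (hw j).le (rightIndicator_nonneg f)
  have hhigh : ∀ f, P f ≤ ∑ j, w j := fun f =>
    Finset.sum_le_sum fun j _ => mul_le_of_le_one_right (hw j).le (rightIndicator_le_one f)
  have hsub : ∀ j, Set.Ioc (∑ i, if i < j then w i else 0) (∑ i, if i ≤ j then w i else 0) ⊆
      levels P (l j) := by
    intro j r hr e he
    have heS := (hl j).1 e he
    obtain ⟨h₀, h₁⟩ := lowLevel_highLevel_rightIndicator (hl j) he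
    have hQ : ∀ i f, 0 ≤ rightIndicator (l i) f ∧ rightIndicator (l i) f ≤ 1 := fun i f =>
      ⟨rightIndicator_nonneg f, rightIndicator_le_one f⟩
    have hQ' : ∀ i, lowLevel (rightIndicator (l i)) e ≤ 1 ∧
        0 ≤ highLevel (rightIndicator (l i)) e := by
      intro i
      have hQi := isPotential_rightIndicator (hl i)
      obtain ⟨y, rfl | rfl⟩ := exists_eq_of_mem_edgeSet heS
      · rw [hQi.lowLevel_eNE, hQi.highLevel_eNE]; exact ⟨(hQ i _).2, (hQ i _).1⟩
      · rw [hQi.lowLevel_eNW, hQi.highLevel_eNW]; exact ⟨(hQ i _).2, (hQ i _).1⟩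
    rw [(hsum e heS).1, (hsum e heS).2]
    refine ⟨lt_of_le_of_lt (Finset.sum_le_sum fun i _ => ?_) hr.1,
      hr.2.trans (Finset.sum_le_sum fun i _ => ?_)⟩
    · split_ifs with hij
      · exact mul_le_of_le_one_right (hw i).le (hQ' i).1
      · have := (rightIndicator_antitone hab hcd hl hchain heS (not_lt.1 hij)).1
        rw [h₀] at this
        exact mul_nonpos_of_nonneg_of_nonpos (hw i).le this
    · split_ifs with hij
      · have := (rightIndicator_antitone hab hcd hl hchain heS hij).2
        rw [h₁] at this
        exact le_mul_of_one_le_right (hw i).le this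
      · exact mul_nonneg (hw i).le (hQ' i).2
  -- Conversely, a level of any crossing trace belongs to one of these intervals.
  have hcover : ∀ k ∈ BrokenTrace.crossing (rectangle a b c d), ∀ r ∈ levels P k, ∃ j, k = l j ∧
      r ∈ Set.Ioc (∑ i, if i < j then w i else 0) (∑ i, if i ≤ j then w i else 0) := by
    intro k hk r hr
    have hr' := hP.level_mem_Ioc hr k.bottom_mem
    obtain ⟨j, hj⟩ := exists_partialSum_lt_le ((hlow _).trans_lt hr'.1) (hr'.2.trans (hhigh _))
    exact ⟨j, hP.crossing_unique hab hcd hk (hl j) hr (hsub j hj), hj⟩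
  intro k hk
  constructor
  · rintro j rfl
    have : levels P (l j) =
        Set.Ioc (∑ i, if i < j then w i else 0) (∑ i, if i ≤ j then w i else 0) := by
      refine subset_antisymm (fun r hr => ?_) (hsub j)
      obtain ⟨i, hi, hr'⟩ := hcover _ hk r hr
      rwa [hinj hi]
    have hlen : (∑ i, if i ≤ j then w i else 0) - (∑ i, if i < j then w i else 0) = w j := by
      rw [← Finset.sum_sub_distrib, Finset.sum_eq_single j]
      · simp
      · intro i _ hij
        simp [le_iff_lt_or_eq, hij]
      · simp
    rw [traceWeight_eq_volume hP hk.1, this, Real.volume_real_Ioc, hlen, max_eq_left (hw j).le]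
  · intro hne
    have : levels P k = ∅ := Set.eq_empty_of_forall_notMem fun r hr => by
      obtain ⟨j, hj, -⟩ := hcover k hk r hr
      exact hne j hj
    rw [traceWeight_eq_volume hP hk.1, this, MeasureTheory.measureReal_empty]

end superposition

/-! ### The decomposition of a flow field -/

section

variable {a b c d : ℤ} {η : Edge → ℝ}

/-- Ordering the crossing traces of positive weight by their levels orders them from left to
right. -/
theorem exists_orderedFamily (hab : a ≤ b) (hcd : c ≤ d) {P : Site → ℝ}
    (hP : IsPotential (rectangle a b c d) η P) :
    ∃ (n : ℕ) (l : Fin n → BrokenTrace),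
      (∀ j, l j ∈ BrokenTrace.crossing (rectangle a b c d)) ∧
      (∀ i j : Fin n, (l i).Le (l j) ↔ i ≤ j) ∧
      (∀ j, 0 < traceWeight (rectangle a b c d) η (l j)) ∧
      ∀ k ∈ BrokenTrace.crossing (rectangle a b c d), (∀ j, k ≠ l j) →
        traceWeight (rectangle a b c d) η k = 0 := by
  classical
  have hfin : {k | k ∈ BrokenTrace.crossing (rectangle a b c d) ∧ (levels P k).Nonempty}.Finite :=
    BrokenTrace.finite_crossing.subset fun _ h => h.1
  have hlev : ∀ k : BrokenTrace, ∃ r, (levels P k).Nonempty → r ∈ levels P k := fun k => by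
    by_cases h : (levels P k).Nonempty
    · exact ⟨h.some, fun _ => h.some_mem⟩
    · exact ⟨0, fun h' => absurd h' h⟩
  choose lev hlev using hlev
  have hwpos : ∀ k ∈ BrokenTrace.crossing (rectangle a b c d), (levels P k).Nonempty →
      0 < traceWeight (rectangle a b c d) η k := by
    intro k hk hne
    rw [traceWeight_eq_volume hP hk.1]
    obtain ⟨A, B, hAB⟩ := exists_levels_eq_Ioc P k
    rw [hAB] at hne ⊢
    have := Set.nonempty_Ioc.1 hne
    rw [Real.volume_real_Ioc]
    exact lt_max_of_lt_left (by linarith)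
  let H : Finset ℝ := hfin.toFinset.image lev
  have hH : ∀ j : Fin H.card, ∃ k, (k ∈ BrokenTrace.crossing (rectangle a b c d) ∧
      (levels P k).Nonempty) ∧ lev k = H.orderEmbOfFin rfl j := by
    intro j
    have := H.orderEmbOfFin_mem rfl j
    obtain ⟨k, hk, hk'⟩ := Finset.mem_image.1 this
    exact ⟨k, hfin.mem_toFinset.1 hk, hk'⟩
  choose l hl hll using hH
  have hmono : ∀ i j, i ≤ j → (l i).Le (l j) := fun i j hij =>
    hP.le_of_levels hab hcd (hl i).1 (hl j).1 (hlev _ (hl i).2) (hlev _ (hl j).2) (by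
      rw [hll, hll]; exact (H.orderEmbOfFin rfl).monotone hij)
  refine ⟨H.card, l, fun j => (hl j).1, fun i j => ⟨fun h => ?_, hmono i j⟩,
    fun j => hwpos _ (hl j).1 (hl j).2, fun k hk hne => ?_⟩
  · by_contra! hji
    have h' := hmono j i hji.le
    have heq : l i = l j := BrokenTrace.eq_of_not_isRightOf hab hcd (hl i).1 (hl j).1
      (fun y hy z hz => h.not_isRightOf hab hcd (hl i).1 (hl j).1 hy hz)
      (fun y hy z hz => h'.not_isRightOf hab hcd (hl j).1 (hl i).1 hz hy)
    have := hll i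
    rw [heq, hll j] at this
    exact hji.ne ((H.orderEmbOfFin rfl).injective this)
  · rw [traceWeight_eq_volume hP hk.1]
    rcases (levels P k).eq_empty_or_nonempty with h | h
    · rw [h, MeasureTheory.measureReal_empty]
    · exfalso
      have : lev k ∈ Set.range (H.orderEmbOfFin rfl) := by
        rw [Finset.range_orderEmbOfFin]
        exact Finset.mem_coe.2 (Finset.mem_image_of_mem _ (hfin.mem_toFinset.2 ⟨hk, h⟩))
      obtain ⟨j, hj⟩ := this
      refine hne j (hP.crossing_unique hab hcd hk (hl j).1 (hlev _ h) ?_)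
      rw [← hj, ← hll]
      exact hlev _ (hl j).2

/-- The pairs of a family that has the crossing weights of `η` are the crossing traces of positive
weight, each paired with its weight. -/
theorem range_eq_of_hasCrossingWeights {S : Set Site} {n : ℕ} {l : Fin n → BrokenTrace}
    {w : Fin n → ℝ} (hl : ∀ j, l j ∈ BrokenTrace.crossing S) (hpos : ∀ j, 0 < w j)
    (hw : HasCrossingWeights S η l w) :
    Set.range (fun j => (l j, w j)) =
      {p | p.1 ∈ BrokenTrace.crossing S ∧ traceWeight S η p.1 = p.2 ∧ 0 < p.2} := by
  ext ⟨k, r⟩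
  constructor
  · rintro ⟨j, h⟩
    obtain ⟨rfl, rfl⟩ := Prod.ext_iff.1 h
    exact ⟨hl j, (hw _ (hl j)).1 j rfl, hpos j⟩
  · rintro ⟨hk, hr, hr'⟩
    dsimp only at hk hr hr'
    by_cases h : ∃ j, k = l j
    · obtain ⟨j, rfl⟩ := h
      exact ⟨j, Prod.ext rfl (((hw _ hk).1 j rfl).symm.trans hr)⟩
    · push Not at h
      have := (hw k hk).2 h
      linarith

end

end BrokenLines

theorem mainTheorem4 (S : Set Site) (hS : IsRectangularDomain S) :
    (∀ (n : ℕ) (l : Fin n → BrokenTrace) (w : Fin n → ℝ),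
      (∀ j, l j ∈ BrokenTrace.crossing S) →
      (∀ i j : Fin n, (i : ℕ) + 1 = j → (l i).Lt (l j)) →
      (∀ j, 0 < w j) →
        (∃! η : Edge → ℝ, IsFlowField S η ∧ HasCrossingWeights S η l w) ∧
        ∀ η : Edge → ℝ, IsFlowField S η → HasCrossingWeights S η l w →
          Decomposes S η l w ∧ WeightsAdd S η) ∧
    (∀ η : Edge → ℝ, IsFlowField S η →
      ∃ (n : ℕ) (l : Fin n → BrokenTrace) (w : Fin n → ℝ),
        (∀ j, l j ∈ BrokenTrace.crossing S) ∧
        (∀ i j : Fin n, (l i).Le (l j) ↔ i ≤ j) ∧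
        (∀ j, 0 < w j) ∧
        HasCrossingWeights S η l w ∧
        Decomposes S η l w ∧
        WeightsAdd S η ∧
        ∀ (n' : ℕ) (l' : Fin n' → BrokenTrace) (w' : Fin n' → ℝ),
          (∀ j, l' j ∈ BrokenTrace.crossing S) → (∀ j, 0 < w' j) →
          HasCrossingWeights S η l' w' →
            Set.range (fun j => (l' j, w' j)) = Set.range (fun j => (l j, w j))) := by
  obtain ⟨a, b, c, d, hab, hcd, rfl⟩ := hS.exists_eq_rectangle
  constructor
  · intro n l w hl hchain hpos
    have hdec : ∀ η : Edge → ℝ, IsFlowField (rectangle a b c d) η →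
        HasCrossingWeights (rectangle a b c d) η l w →
        Decomposes (rectangle a b c d) η l w ∧ WeightsAdd (rectangle a b c d) η := by
      intro η hη hw
      have hP := isPotential_potential hη
      have hadd := hP.weightsAdd hab hcd
      exact ⟨decomposes hη hP hadd hl (injective_of_chain hab hcd hl hchain) hw, hadd⟩
    refine ⟨⟨∑ j, w j • (l j).flow, ⟨isFlowField_sum hl hpos,
      hasCrossingWeights_sum hab hcd hl hchain hpos⟩, ?_⟩, hdec⟩
    rintro η ⟨hη, hw⟩
    exact (hdec η hη hw).1.1
  · intro η hη
    have hP := isPotential_potential hη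
    have hadd := hP.weightsAdd hab hcd
    obtain ⟨n, l, hl, hle, hpos, hzero⟩ := exists_orderedFamily hab hcd hP
    have hinj : Function.Injective l := fun i j h => by
      have h₁ := (hle i j).1 (h ▸ (hle i i).2 le_rfl)
      have h₂ := (hle j i).1 (h ▸ (hle i i).2 le_rfl)
      exact le_antisymm h₁ h₂
    have hw : HasCrossingWeights (rectangle a b c d) η l
        (fun j => traceWeight (rectangle a b c d) η (l j)) :=
      fun k hk => ⟨fun j hj => by rw [hj], hzero k hk⟩
    refine ⟨n, l, _, hl, hle, hpos, hw, decomposes hη hP hadd hl hinj hw, hadd, ?_⟩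
    intro n' l' w' hl' hpos' hw'
    rw [range_eq_of_hasCrossingWeights hl' hpos' hw', range_eq_of_hasCrossingWeights hl hpos hw]
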